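/- For each $N$ in a sequence of positive integers tending to infinity, let $M=M(N)$ be a divisor of $N$ with $M=o(N)$ (in particular $M$ may be fixed). Consider the stochastic block model on the vertex set $V=\{1,\dots,N\}$, partitioned into $M$ blocks of $N/M$ vertices each, with $B(v)\in\{1,\dots,M\}$ denoting the block of $v$. The random undirected graph has independent edges (loops $\{v,v\}$ are allowed and count once in the degree): $\{v,w\}$ is an edge with probability $p_m=p_m(N)\in[0,1]$ if $B(v)=B(w)=m$, and with probability $q=q(N)\in[0,1]$ if $B(v)\ne B(w)$. Put $$\gamma_m=\frac NM\,p_m+(M-1)\frac NM\,q ,$$ the expected degree of a vertex in block $m$, and let $\gamma_{\min},\gamma_{\max},p_{\min},p_{\max}$ be the minima and maxima of $\gamma_m$ and $p_m$ over $m$. Assume that, as $N\to\infty$, $\gamma_{\min}>0$ for all large $N$ and $$\max_{1\le m\le M}\ \frac{M\log^4 N}{Np_m+N(M-1)q}\cdot\frac{\gamma_{\max}^2}{\gamma_{\min}^2}\longrightarrow 0,$$ $$\Big(\frac{M\log N}{N}\Big)^{1/4}p_{\min}^{5/4}\,p_{\max}^{1/2}=o\big(((M-1)q)^2\big).$$ For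 a realization of the graph let $d_v$ be the degree of $v$, let $\pi_v=d_v/\sum_{w}d_w$ be the invariant distribution of simple random walk, let $H_{vw}\in[0,\infty]$ be the expected time at which the simple random walk started in $v$ first visits $w$ (so $H_{ww}=0$), and let $H_w=\sum_{v\in V}\pi_vH_{vw}$. Then asymptotically almost surely $$H_w=\frac NM\cdot\frac{\sum_{m=1}^M\gamma_m}{\gamma_{B(w)}}\,(1+o(1))\qquad\text{uniformly in } w\in V ,$$ that is, for every $\varepsilon>0$, the probability that for all $w\in V$ the quantity $H_w$ is finite and $$\Big|\frac{H_w}{\frac NM\sum_{m}\gamma_m/\gamma_{B(w)}}-1\Big|\le\varepsilon$$ tends to $1$ as $N\to\infty$. -/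

import Mathlib

open Filter Topology MeasureTheory ProbabilityTheory Asymptotics
open scoped ENNReal unitInterval

noncomputable section

namespace SBM

/-! ### Graphs with loops and the simple random walk -/

/-- An undirected graph on `{1, …, N}` in which loops are allowed: each unordered pair
(including the pairs `s(v, v)`) is declared to be an edge (`true`) or not (`false`). -/
abbrev LoopGraph (N : ℕ) : Type := Sym2 (Fin N) → Bool

variable {N M : ℕ}

/-- The set of neighbours of `v`; it contains `v` itself iff there is a loop at `v`. -/
def neighbors (G : LoopGraph N) (v : Fin N) : Finset (Fin N) :=
  Finset.univ.filter fun w => G s(v, w) = true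

/-- The degree `d_v = ∑_w a_{v,w}` (a loop counts once). -/
def degree (G : LoopGraph N) (v : Fin N) : ℕ := (neighbors G v).card

open scoped Classical in
/-- One step of simple random walk: a uniformly chosen neighbour of the current position. (At a
vertex of degree zero, where the walk is not defined, it is declared to stay put.) -/
def stepPMF (G : LoopGraph N) (v : Fin N) : PMF (Fin N) :=
  if h : (neighbors G v).Nonempty then PMF.uniformOfFinset (neighbors G v) h else PMF.pure v

/-- The transition kernel of simple random walk. -/
def stepKernel (G : LoopGraph N) : Kernel (Fin N) (Fin N) :=
  Kernel.ofFunOfCountable fun v => (stepPMF G v).toMeasure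

instance (G : LoopGraph N) : IsMarkovKernel (stepKernel G) :=
  ⟨fun v => by
    change IsProbabilityMeasure ((stepPMF G v).toMeasure)
    infer_instance⟩

/-- The law of `X_{t+1}` given `X_0, …, X_t`: it depends on `X_t` only. -/
def historyKernel (G : LoopGraph N) (t : ℕ) :
    Kernel (∀ _ : Finset.Iic t, Fin N) (Fin N) :=
  (stepKernel G).comap (fun x => x ⟨t, Finset.mem_Iic.2 le_rfl⟩) (measurable_pi_apply _)

instance (G : LoopGraph N) (t : ℕ) : IsMarkovKernel (historyKernel G t) := by
  unfold historyKernel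
  infer_instance

/-- The law, on the space of trajectories `ℕ → {1, …, N}`, of simple random walk started in `v`. -/
def walkLaw (G : LoopGraph N) (v : Fin N) : Measure (ℕ → Fin N) :=
  Kernel.trajMeasure (X := fun _ => Fin N) (Measure.dirac v) (historyKernel G)

/-- The first time `t ≥ 0` at which the trajectory `x` is in `w` (`∞` if there is none). -/
def hittingTime (w : Fin N) (x : ℕ → Fin N) : ℕ∞ :=
  hittingAfter (fun (t : ℕ) (y : ℕ → Fin N) => y t) {w} 0 x

/-- `H_{vw}`, the expected time that simple random walk started in `v` takes to reach `w`. -/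
def expectedHittingTime (G : LoopGraph N) (v w : Fin N) : ℝ≥0∞ :=
  ∫⁻ x, (hittingTime w x : ℝ≥0∞) ∂(walkLaw G v)

/-- The invariant distribution `π_v = d_v / ∑_w d_w`. -/
def stationary (G : LoopGraph N) (v : Fin N) : ℝ≥0∞ :=
  (degree G v : ℝ≥0∞) / ∑ w, (degree G w : ℝ≥0∞)

/-- `H_w = ∑_v π_v H_{vw}`. -/
def averageHittingTime (G : LoopGraph N) (w : Fin N) : ℝ≥0∞ :=
  ∑ v, stationary G v * expectedHittingTime G v w

/-! ### The stochastic block model -/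

/-- The data of a stochastic block model on `N` vertices with `M` blocks of equal size `N / M`:
the assignment of the vertices to the blocks, the edge probabilities `p_m` inside the blocks and
the edge probability `q` between different blocks. -/
structure BlockModel (N M : ℕ) where
  /-- `B(v)`, the block of the vertex `v`. -/
  block : Fin N → Fin M
  card_block : ∀ m, M * (Finset.univ.filter fun v => block v = m).card = N
  p : Fin M → I
  q : I

namespace BlockModel

variable (S : BlockModel N M)

/-- The probability of the edge `{v, w}`: `p_m` if both ends are in block `m`, and `q` if the ends
are in different blocks. -/
def edgeProb : Sym2 (Fin N) → I :=
  Sym2.lift ⟨fun v w => if S.block v = S.block w then S.p (S.block v) else S.q, by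
    intro v w
    by_cases h : S.block v = S.block w
    · simp [h]
    · simp [h, Ne.symm h]⟩

/-- The law of the random graph: all edges (and loops) are independent, and `e` is present with
probability `edgeProb e`. -/
def graphLaw : Measure (LoopGraph N) :=
  Measure.pi fun e => bernoulliMeasure true false (S.edgeProb e)

/-- `γ_m = (N/M) p_m + (M-1) (N/M) q`, the expected degree of a vertex in block `m`. -/
def γ (m : Fin M) : ℝ :=
  (N : ℝ) / M * (S.p m : ℝ) + ((M : ℝ) - 1) * ((N : ℝ) / M) * (S.q : ℝ)

def γmin : ℝ := ⨅ m, S.γ m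

def γmax : ℝ := ⨆ m, S.γ m

def pmin : ℝ := ⨅ m, (S.p m : ℝ)

def pmax : ℝ := ⨆ m, (S.p m : ℝ)

end BlockModel

/-- The connectivity condition
`M log⁴ N / (N p_m + N (M-1) q) * γ_max² / γ_min² → 0`, uniformly in the block `m`. The quotients
have to make sense, so `γ_min > 0` (for all large `k`) is part of the condition. -/
def ConnectivityCondition (N M : ℕ → ℕ) (S : ∀ k, BlockModel (N k) (M k)) : Prop :=
  (∀ᶠ k in atTop, 0 < (S k).γmin) ∧
  Tendsto (fun k => ⨆ m : Fin (M k),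
      (M k : ℝ) * Real.log (N k) ^ 4 /
          ((N k : ℝ) * ((S k).p m : ℝ) + (N k : ℝ) * ((M k : ℝ) - 1) * ((S k).q : ℝ)) *
        ((S k).γmax ^ 2 / (S k).γmin ^ 2))
    atTop (𝓝 0)

/-- The condition `((M-1) q)² ≫ (M log N / N)^{1/4} p_min^{5/4} p_max^{1/2}`. -/
def CrossBlockCondition (N M : ℕ → ℕ) (S : ∀ k, BlockModel (N k) (M k)) : Prop :=
  (fun k => ((M k : ℝ) * Real.log (N k) / (N k : ℝ)) ^ (1 / 4 : ℝ) *
      (S k).pmin ^ (5 / 4 : ℝ) * (S k).pmax ^ (1 / 2 : ℝ))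
    =o[atTop] fun k => (((M k : ℝ) - 1) * ((S k).q : ℝ)) ^ 2

end SBM

end

/-!
For a connected graph with adjacency matrix `A`, degrees `d` and Laplacian `L = D - A`, the expected
times `h v = H_{vw}` to reach `w` solve `L h = d` off `w`. Hence `φ = π_w (H_w - h)` solves the
Poisson equation `φ - P φ = 1_w - π_w` of simple random walk, and evaluating it at `w` gives
`π_w H_w = 1 - 2 π_w + (E(P φ) + A w w) / d w` with the Dirichlet form `E`. A Poincaré inequality
bounds `E(P φ) / d w` by a multiple of `d_max / (c d_min)`, where `c` is the spectral gap of `L`.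

For the block model, Chernoff bounds show that all degrees are close to their means and that the
edges between different blocks alone form an expander whose cuts and degrees are of order
`y = (M - 1) (N / M) q`. By Cheeger's inequality the spectral gap of `L` is then at least `y / 64`.
So `H_w` is close to `1 / π_w` as soon as `log N ≪ y` and `γ_max ≪ y γ_min`. Both follow from
`log⁴ N * γ_max² ≪ γ_min³` and `γ_min ≪ y²`, which are what the two conditions on the parameters
say about `y`.
-/

open scoped Matrix

noncomputable section

namespace SBM

/-! ### Symmetric weights -/

section SymmetricWeights

variable {V : Type*} [Fintype V] {A : Matrix V V ℝ} {f : V → ℝ}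

/-- The total weight `∑_w A v w` at `v`, which for an adjacency matrix is the degree of `v`. -/
def rowSum (A : Matrix V V ℝ) (v : V) : ℝ := ∑ w, A v w

/-- The Dirichlet form `(1/2) ∑_{v,w} A v w (f v - f w)²` of the weights `A`. -/
def dirichletForm (A : Matrix V V ℝ) (f : V → ℝ) : ℝ := (∑ v, ∑ w, A v w * (f v - f w) ^ 2) / 2

/-- The Poincaré inequality with constant `c`. The minimum over `m` of `∑_v (f v - m)²` is the
variance of `f`, so the inequality says that the spectral gap of the Laplacian is at least `c`. -/
def Poincare (A : Matrix V V ℝ) (c : ℝ) : Prop :=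
  ∀ f : V → ℝ, ∃ m : ℝ, c * ∑ v, (f v - m) ^ 2 ≤ dirichletForm A f

lemma sum_mul_swap (hA : A.IsSymm) (F : V → V → ℝ) :
    ∑ v, ∑ w, A v w * F w v = ∑ v, ∑ w, A v w * F v w := by
  rw [Finset.sum_comm]
  simp only [hA.apply]

lemma dirichletForm_nonneg (hA : ∀ v w, 0 ≤ A v w) (f : V → ℝ) : 0 ≤ dirichletForm A f :=
  div_nonneg (Finset.sum_nonneg fun v _ => Finset.sum_nonneg fun w _ =>
    mul_nonneg (hA v w) (sq_nonneg _)) zero_le_two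

lemma Poincare.mono {B : Matrix V V ℝ} {c : ℝ} (h : Poincare A c) (hAB : ∀ v w, A v w ≤ B v w) :
    Poincare B c := by
  intro f
  obtain ⟨m, hm⟩ := h f
  refine ⟨m, hm.trans ?_⟩
  unfold dirichletForm
  gcongr with v _ w _
  exact hAB v w

lemma Poincare.eq_of_dirichletForm_eq_zero {c : ℝ} (h : Poincare A c) (hc : 0 < c)
    (hf : dirichletForm A f = 0) (v w : V) : f v = f w := by
  obtain ⟨m, hm⟩ := h f
  have hsum : ∑ u, (f u - m) ^ 2 = 0 :=
    le_antisymm (nonpos_of_mul_nonpos_right (hm.trans_eq hf) hc)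
      (Finset.sum_nonneg fun u _ => sq_nonneg _)
  have hconst (u : V) : f u = m := sub_eq_zero.1 <| pow_eq_zero_iff two_ne_zero |>.1 <|
    (Finset.sum_eq_zero_iff_of_nonneg fun u _ => sq_nonneg _).1 hsum u (Finset.mem_univ u)
  rw [hconst, hconst]

/-- Among all constants `m`, the weighted mean of `f` minimises `∑_v d v (f v - m)²`. -/
lemma Poincare.mul_sum_mul_sq_le {c Δ : ℝ} (h : Poincare A c) (hc : 0 ≤ c) {d : V → ℝ}
    (hd : ∀ v, 0 ≤ d v) (hdΔ : ∀ v, d v ≤ Δ) (hf : d ⬝ᵥ f = 0) (hΔ : 0 ≤ Δ) :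
    c * ∑ v, d v * f v ^ 2 ≤ Δ * dirichletForm A f := by
  obtain ⟨m, hm⟩ := h f
  have hmean : ∑ v, d v * f v ^ 2 ≤ ∑ v, d v * (f v - m) ^ 2 := by
    have hexpand : ∑ v, d v * (f v - m) ^ 2 =
        ∑ v, d v * f v ^ 2 - 2 * m * (d ⬝ᵥ f) + m ^ 2 * ∑ v, d v := by
      simp only [dotProduct, Finset.mul_sum, ← Finset.sum_sub_distrib, ← Finset.sum_add_distrib]
      exact Finset.sum_congr rfl fun v _ => by ring
    rw [hexpand, hf]
    have hdm : 0 ≤ m ^ 2 * ∑ v, d v :=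
      mul_nonneg (sq_nonneg m) (Finset.sum_nonneg fun v _ => hd v)
    linarith
  calc c * ∑ v, d v * f v ^ 2 ≤ c * ∑ v, Δ * (f v - m) ^ 2 := by
        refine mul_le_mul_of_nonneg_left (hmean.trans ?_) hc
        exact Finset.sum_le_sum fun v _ => mul_le_mul_of_nonneg_right (hdΔ v) (sq_nonneg _)
    _ = Δ * (c * ∑ v, (f v - m) ^ 2) := by rw [← Finset.mul_sum]; ring
    _ ≤ Δ * dirichletForm A f := by gcongr

variable [DecidableEq V]

/-- The Laplacian `D - A`, where `D` is the diagonal matrix of the row sums. -/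
def laplacian (A : Matrix V V ℝ) : Matrix V V ℝ := Matrix.diagonal (rowSum A) - A

lemma laplacian_mulVec (A : Matrix V V ℝ) (f : V → ℝ) :
    laplacian A *ᵥ f = rowSum A * f - A *ᵥ f := by
  ext v
  simp [laplacian, Matrix.sub_mulVec, Matrix.mulVec_diagonal]

lemma laplacian_mulVec_apply (A : Matrix V V ℝ) (f : V → ℝ) (v : V) :
    (laplacian A *ᵥ f) v = ∑ w, A v w * (f v - f w) := by
  rw [laplacian_mulVec]
  simp only [rowSum, Pi.sub_apply, Pi.mul_apply, Finset.sum_mul, Matrix.mulVec, dotProduct,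
    ← Finset.sum_sub_distrib, mul_sub]

lemma laplacian_mulVec_const (A : Matrix V V ℝ) (c : ℝ) :
    laplacian A *ᵥ (fun _ => c) = 0 := by
  ext v
  simp [laplacian_mulVec_apply]

lemma sum_laplacian_mulVec (hA : A.IsSymm) (f : V → ℝ) : ∑ v, (laplacian A *ᵥ f) v = 0 := by
  simp only [laplacian_mulVec_apply, mul_sub, Finset.sum_sub_distrib]
  rw [sum_mul_swap hA (fun v _ => f v), sub_self]

lemma dotProduct_laplacian_mulVec (hA : A.IsSymm) (f : V → ℝ) :
    f ⬝ᵥ laplacian A *ᵥ f = dirichletForm A f := by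
  have hswap := sum_mul_swap hA fun v w => f v * (f v - f w)
  rw [dirichletForm, eq_div_iff two_ne_zero, mul_two]
  simp only [dotProduct, laplacian_mulVec_apply, Finset.mul_sum]
  calc ∑ v, ∑ w, f v * (A v w * (f v - f w)) + ∑ v, ∑ w, f v * (A v w * (f v - f w))
      = ∑ v, ∑ w, A v w * (f v * (f v - f w)) + ∑ v, ∑ w, A v w * (f w * (f w - f v)) := by
        simp only [mul_left_comm (f _), hswap]
    _ = ∑ v, ∑ w, A v w * (f v - f w) ^ 2 := by
        simp only [← Finset.sum_add_distrib]
        exact Finset.sum_congr rfl fun v _ => Finset.sum_congr rfl fun w _ => by ring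

end SymmetricWeights

/-! ### Hitting potentials -/

section HittingPotential

variable {V : Type*} [Fintype V] [DecidableEq V] {A : Matrix V V ℝ} {w : V} {h : V → ℝ} {c : ℝ}

/-- The boundary value problem solved by the expected times to reach `w`: for the random walk with
transition probabilities `A v u / rowSum A v` it reads `h v = 1 + ∑_u A v u / rowSum A v * h u`
off `w` and `h w = 0`. -/
structure IsHittingPotential (A : Matrix V V ℝ) (w : V) (h : V → ℝ) : Prop where
  apply_self : h w = 0
  laplacian_eq : ∀ v, v ≠ w → (laplacian A *ᵥ h) v = rowSum A v

/-- Since the entries of `L h` sum to `0`, its value at `w` is determined by the others. -/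
lemma IsHittingPotential.laplacian_mulVec_eq (hh : IsHittingPotential A w h) (hA : A.IsSymm) :
    laplacian A *ᵥ h = rowSum A - Pi.single w (∑ v, rowSum A v) := by
  ext v
  obtain rfl | hv := eq_or_ne v w
  · have hsum := sum_laplacian_mulVec hA h
    rw [← Finset.add_sum_erase _ _ (Finset.mem_univ v),
      Finset.sum_congr rfl fun u hu => hh.laplacian_eq u (Finset.ne_of_mem_erase hu)] at hsum
    rw [Pi.sub_apply, Pi.single_eq_same, ← Finset.add_sum_erase _ _ (Finset.mem_univ v)]
    linarith
  · simp [hh.laplacian_eq v hv, hv]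

lemma laplacian_add_single_mulVec (A : Matrix V V ℝ) (w : V) (f : V → ℝ) :
    (laplacian A + Matrix.single w w 1) *ᵥ f = laplacian A *ᵥ f + Pi.single w (f w) := by
  rw [Matrix.add_mulVec, Matrix.single_mulVec, one_mul]
  rfl

/-- `L + 1_w 1_wᵀ` is the Laplacian of the walk killed at `w`: its quadratic form is
`f ↦ E(f) + f(w)²`. -/
lemma injective_laplacian_add_single (hA : A.IsSymm) (hA0 : ∀ v u, 0 ≤ A v u)
    (hP : Poincare A c) (hc : 0 < c) (w : V) :
    Function.Injective (laplacian A + Matrix.single w w 1).mulVecLin := by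
  rw [injective_iff_map_eq_zero]
  intro g hg
  rw [Matrix.mulVecLin_apply, laplacian_add_single_mulVec] at hg
  have hquad : dirichletForm A g + g w ^ 2 = 0 := by
    have := congrArg (g ⬝ᵥ ·) hg
    simpa [dotProduct_add, dotProduct_laplacian_mulVec hA, sq] using this
  have hE : dirichletForm A g = 0 :=
    le_antisymm (by linarith [sq_nonneg (g w)]) (dirichletForm_nonneg hA0 g)
  have hgw : g w = 0 := by simpa [hE] using hquad
  ext v
  rw [hP.eq_of_dirichletForm_eq_zero hc hE v w, hgw, Pi.zero_apply]

lemma exists_isHittingPotential (hA : A.IsSymm) (hA0 : ∀ v u, 0 ≤ A v u)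
    (hP : Poincare A c) (hc : 0 < c) (w : V) : ∃ h, IsHittingPotential A w h := by
  obtain ⟨h, hh⟩ := LinearMap.injective_iff_surjective.1
    (injective_laplacian_add_single hA hA0 hP hc w) (rowSum A - Pi.single w (∑ v, rowSum A v))
  rw [Matrix.mulVecLin_apply, laplacian_add_single_mulVec] at hh
  have hw : h w = 0 := by
    have := congrArg (fun g : V → ℝ => ∑ v, g v) hh
    simpa [Finset.sum_add_distrib, sum_laplacian_mulVec hA] using this
  refine ⟨h, hw, fun v hv => ?_⟩
  simpa [hw, hv] using congrFun hh v

lemma IsHittingPotential.nonneg (hh : IsHittingPotential A w h) (hA0 : ∀ v u, 0 ≤ A v u)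
    (hd : ∀ v, 0 < rowSum A v) (v : V) : 0 ≤ h v := by
  have : Nonempty V := ⟨w⟩
  obtain ⟨u, hu⟩ := Finite.exists_min h
  refine le_trans ?_ (hu v)
  obtain rfl | huw := eq_or_ne u w
  · exact hh.apply_self.ge
  · have hnonpos : (laplacian A *ᵥ h) u ≤ 0 := by
      rw [laplacian_mulVec_apply]
      exact Finset.sum_nonpos fun x _ =>
        mul_nonpos_of_nonneg_of_nonpos (hA0 u x) (sub_nonpos.2 (hu x))
    rw [hh.laplacian_eq u huw] at hnonpos
    exact absurd (hd u) hnonpos.not_gt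

end HittingPotential

/-! ### The stationary average of a hitting potential -/

section StationaryMean

variable {V : Type*} [Fintype V] {A : Matrix V V ℝ} {w : V} {h : V → ℝ}

/-- The average of `h` with respect to the stationary distribution `rowSum A v / ∑ u, rowSum A u`
of the random walk with weights `A`. -/
def stationaryMean (A : Matrix V V ℝ) (h : V → ℝ) : ℝ := (rowSum A ⬝ᵥ h) / ∑ v, rowSum A v

variable [DecidableEq V]

/-- With `π` the stationary distribution and `H` the stationary mean of a hitting potential `h`,
`φ = π w * (H - h)` solves the Poisson equation `φ - P φ = 1_w - π w` for the transition operator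
`P` of the walk. This is the function `P φ`. -/
def steppedPoissonSolution (A : Matrix V V ℝ) (w : V) (h : V → ℝ) : V → ℝ := fun v =>
  rowSum A w / (∑ u, rowSum A u) * (stationaryMean A h + 1 - h v) - (Pi.single w 1 : V → ℝ) v

lemma rowSum_dotProduct_steppedPoissonSolution (hD : ∑ v, rowSum A v ≠ 0) (w : V) (h : V → ℝ) :
    rowSum A ⬝ᵥ steppedPoissonSolution A w h = 0 := by
  have hexpand : rowSum A ⬝ᵥ steppedPoissonSolution A w h =
      rowSum A w / (∑ u, rowSum A u) *
        ((∑ v, rowSum A v) * (stationaryMean A h + 1) - rowSum A ⬝ᵥ h) -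
      rowSum A ⬝ᵥ Pi.single w 1 := by
    simp only [steppedPoissonSolution, dotProduct, Finset.sum_mul, Finset.mul_sum,
      ← Finset.sum_sub_distrib]
    exact Finset.sum_congr rfl fun v _ => by ring
  rw [hexpand, dotProduct_single_one, stationaryMean]
  field_simp
  ring

lemma laplacian_mulVec_steppedPoissonSolution (hA : A.IsSymm) (hD : ∑ v, rowSum A v ≠ 0)
    (hh : IsHittingPotential A w h) :
    laplacian A *ᵥ steppedPoissonSolution A w h =
      A.col w - (rowSum A w / ∑ v, rowSum A v) • rowSum A := by
  have hsplit : steppedPoissonSolution A w h =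
      (fun _ => rowSum A w / (∑ u, rowSum A u) * (stationaryMean A h + 1)) -
        (rowSum A w / ∑ u, rowSum A u) • h - Pi.single w 1 := by
    ext v
    simp only [steppedPoissonSolution, Pi.sub_apply, Pi.smul_apply, smul_eq_mul]
    ring
  rw [hsplit, Matrix.mulVec_sub, Matrix.mulVec_sub, laplacian_mulVec_const, Matrix.mulVec_smul,
    hh.laplacian_mulVec_eq hA, laplacian_mulVec, Matrix.mulVec_single_one]
  ext v
  obtain rfl | hv := eq_or_ne v w
  · simp only [Pi.sub_apply, Pi.zero_apply, Pi.smul_apply, Pi.single_eq_same, Pi.mul_apply,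
      smul_eq_mul]
    field_simp
    ring
  · simp [hv, neg_add_eq_sub]

lemma dirichletForm_steppedPoissonSolution (hA : A.IsSymm) (hD : ∑ v, rowSum A v ≠ 0)
    (hh : IsHittingPotential A w h) :
    dirichletForm A (steppedPoissonSolution A w h) = (A *ᵥ steppedPoissonSolution A w h) w := by
  rw [← dotProduct_laplacian_mulVec hA, laplacian_mulVec_steppedPoissonSolution hA hD hh,
    dotProduct_sub, dotProduct_smul, dotProduct_comm _ (rowSum A),
    rowSum_dotProduct_steppedPoissonSolution hD, smul_zero, sub_zero, dotProduct_comm]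
  exact Finset.sum_congr rfl fun v _ => by rw [Matrix.col_apply, hA.apply]

/-- The stationary mean of the hitting potential is close to `1 / π w` as soon as the Dirichlet
form of `steppedPoissonSolution` is small compared with `rowSum A w`. -/
lemma mul_stationaryMean_sub_one (hA : A.IsSymm) (hD : ∑ v, rowSum A v ≠ 0) (hw : rowSum A w ≠ 0)
    (hh : IsHittingPotential A w h) :
    rowSum A w / (∑ v, rowSum A v) * stationaryMean A h - 1 =
      (dirichletForm A (steppedPoissonSolution A w h) + A w w) / rowSum A w -
        2 * (rowSum A w / ∑ v, rowSum A v) := by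
  have hL := congrFun (laplacian_mulVec_steppedPoissonSolution hA hD hh) w
  rw [laplacian_mulVec, Pi.sub_apply, ← dirichletForm_steppedPoissonSolution hA hD hh] at hL
  have hψw : steppedPoissonSolution A w h w =
      rowSum A w / (∑ u, rowSum A u) * (stationaryMean A h + 1) - 1 := by
    simp [steppedPoissonSolution, hh.apply_self]
  simp only [Pi.mul_apply, hψw, Pi.sub_apply, Pi.smul_apply, Matrix.col_apply, smul_eq_mul] at hL
  rw [eq_sub_iff_add_eq, eq_div_iff hw]
  linarith

lemma dirichletForm_steppedPoissonSolution_le {c δ Δ : ℝ} (hA : A.IsSymm)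
    (hA0 : ∀ v u, 0 ≤ A v u) (hA1 : ∀ v u, A v u ≤ 1) (hP : Poincare A c) (hc : 0 < c) (hδ : 0 < δ)
    (hdδ : ∀ v, δ ≤ rowSum A v) (hdΔ : ∀ v, rowSum A v ≤ Δ) (hD : ∑ v, rowSum A v ≠ 0)
    (hh : IsHittingPotential A w h) :
    dirichletForm A (steppedPoissonSolution A w h) ≤ Δ / (c * δ) * rowSum A w := by
  set ψ := steppedPoissonSolution A w h
  set E := dirichletForm A ψ with hE
  have hd (v : V) : 0 < rowSum A v := hδ.trans_le (hdδ v)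
  have hE0 : 0 ≤ E := dirichletForm_nonneg hA0 ψ
  have hCS : E ^ 2 ≤ rowSum A w * ∑ v, ψ v ^ 2 := by
    rw [hE, dirichletForm_steppedPoissonSolution hA hD hh]
    refine (Finset.sum_mul_sq_le_sq_mul_sq _ _ _).trans ?_
    gcongr with v
    exact Finset.sum_le_sum fun v _ => pow_le_of_le_one (hA0 w v) (hA1 w v) two_ne_zero
  have hgap : c * δ * ∑ v, ψ v ^ 2 ≤ Δ * E := by
    refine le_trans ?_ (hP.mul_sum_mul_sq_le hc.le (fun v => (hd v).le) hdΔ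
      (rowSum_dotProduct_steppedPoissonSolution hD w h) ((hd w).le.trans (hdΔ w)))
    rw [mul_assoc, Finset.mul_sum]
    gcongr with v
    exact hdδ v
  obtain hE0' | hEpos := hE0.eq_or_lt
  · rw [← hE0']
    have := (hd w).trans_le (hdΔ w)
    have := hd w
    positivity
  · rw [div_mul_eq_mul_div, le_div_iff₀ (by positivity)]
    refine le_of_mul_le_mul_right ?_ hEpos
    calc E * (c * δ) * E = c * δ * E ^ 2 := by ring
      _ ≤ c * δ * (rowSum A w * ∑ v, ψ v ^ 2) := by gcongr
      _ = rowSum A w * (c * δ * ∑ v, ψ v ^ 2) := by ring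
      _ ≤ rowSum A w * (Δ * E) := by
        have := hd w
        gcongr
      _ = Δ * rowSum A w * E := by ring

theorem IsHittingPotential.abs_mul_stationaryMean_sub_one_le {c δ Δ : ℝ}
    (hh : IsHittingPotential A w h) (hA : A.IsSymm) (hA0 : ∀ v u, 0 ≤ A v u)
    (hA1 : ∀ v u, A v u ≤ 1) (hP : Poincare A c) (hc : 0 < c) (hδ : 0 < δ)
    (hdδ : ∀ v, δ ≤ rowSum A v) (hdΔ : ∀ v, rowSum A v ≤ Δ) :
    |rowSum A w / (∑ v, rowSum A v) * stationaryMean A h - 1| ≤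
      2 * (rowSum A w / ∑ v, rowSum A v) + 1 / δ + Δ / (c * δ) := by
  have hd (v : V) : 0 < rowSum A v := hδ.trans_le (hdδ v)
  have hDw : 0 < ∑ v, rowSum A v := Finset.sum_pos (fun v _ => hd v) ⟨w, Finset.mem_univ w⟩
  rw [mul_stationaryMean_sub_one hA hDw.ne' (hd w).ne' hh]
  set E := dirichletForm A (steppedPoissonSolution A w h)
  have hupper : (E + A w w) / rowSum A w ≤ Δ / (c * δ) + 1 / δ := by
    rw [add_div]
    refine add_le_add ?_ (div_le_div₀ zero_le_one (hA1 w w) hδ (hdδ w))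
    rw [div_le_iff₀ (hd w)]
    exact dirichletForm_steppedPoissonSolution_le hA hA0 hA1 hP hc hδ hdδ hdΔ hDw.ne' hh
  have hlower : 0 ≤ (E + A w w) / rowSum A w :=
    div_nonneg (add_nonneg (dirichletForm_nonneg hA0 _) (hA0 w w)) (hd w).le
  have hπ : 0 < rowSum A w / ∑ v, rowSum A v := div_pos (hd w) hDw
  have hδ' : 0 < 1 / δ := one_div_pos.2 hδ
  have hΔ' : 0 < Δ / (c * δ) := div_pos ((hd w).trans_le (hdΔ w)) (mul_pos hc hδ)
  exact abs_le.2 ⟨by linarith, by linarith⟩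

end StationaryMean

/-! ### Cheeger's inequality -/

section Cheeger

variable {V : Type*} [Fintype V] {A : Matrix V V ℝ} {κ : ℝ}

lemma exists_median [Nonempty V] {α : Type*} [LinearOrder α] (f : V → α) :
    ∃ m, 2 * (Finset.univ.filter fun v => m < f v).card ≤ Fintype.card V ∧
      2 * (Finset.univ.filter fun v => f v < m).card ≤ Fintype.card V := by
  classical
  set T := Finset.univ.filter fun v =>
    2 * (Finset.univ.filter fun u => f v < f u).card ≤ Fintype.card V
  have hT : T.Nonempty := by
    obtain ⟨v, hv⟩ := Finite.exists_max f
    refine ⟨v, Finset.mem_filter.2 ⟨Finset.mem_univ _, ?_⟩⟩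
    simp [Finset.filter_eq_empty_iff.2 fun u _ => not_lt.2 (hv u)]
  obtain ⟨v₀, hv₀, hmin⟩ := T.exists_min_image f hT
  refine ⟨f v₀, (Finset.mem_filter.1 hv₀).2, ?_⟩
  by_contra! hlt
  have hbelow : (Finset.univ.filter fun v => f v < f v₀).Nonempty := by
    rw [← Finset.card_pos]
    omega
  obtain ⟨v₁, hv₁, hmax⟩ := Finset.exists_max_image _ f hbelow
  have hsub : (Finset.univ.filter fun u => f v₁ < f u) ⊆
      (Finset.univ.filter fun v => f v < f v₀)ᶜ := fun u hu =>
    Finset.mem_compl.2 fun hu' => (hmax u hu').not_gt (Finset.mem_filter.1 hu).2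
  have hcard := Finset.card_le_card hsub
  rw [Finset.card_compl] at hcard
  have hv₁T : v₁ ∈ T := Finset.mem_filter.2 ⟨Finset.mem_univ _, by omega⟩
  exact (hmin v₁ hv₁T).not_gt (Finset.mem_filter.1 hv₁).2

lemma integrableOn_indicator_Iic (x R : ℝ) :
    IntegrableOn (Set.indicator (Set.Iic x) 1 : ℝ → ℝ) (Set.Ioc 0 R) :=
  IntegrableOn.indicator (integrableOn_const measure_Ioc_lt_top.ne) measurableSet_Iic

lemma setIntegral_indicator_Iic {x R : ℝ} (hx : 0 ≤ x) (hxR : x ≤ R) :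
    ∫ t in Set.Ioc 0 R, Set.indicator (Set.Iic x) (1 : ℝ → ℝ) t = x := by
  rw [setIntegral_indicator measurableSet_Iic, Set.Ioc_inter_Iic, min_eq_right hxR]
  simp [hx]

lemma integrableOn_const_mul_indicator_Iic_sub (a x y R : ℝ) :
    IntegrableOn (fun t => a * (Set.indicator (Set.Iic x) 1 t - Set.indicator (Set.Iic y) 1 t))
      (Set.Ioc 0 R) :=
  ((integrableOn_indicator_Iic x R).sub (integrableOn_indicator_Iic y R)).const_mul a

lemma sum_mul_sub_min (hA : A.IsSymm) (g : V → ℝ) :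
    ∑ v, ∑ w, A v w * (g v - min (g v) (g w)) = (∑ v, ∑ w, A v w * |g v - g w|) / 2 := by
  rw [eq_div_iff two_ne_zero, mul_two]
  nth_rw 2 [← sum_mul_swap hA]
  simp only [← Finset.sum_add_distrib]
  refine Finset.sum_congr rfl fun v _ => Finset.sum_congr rfl fun w _ => ?_
  rw [← mul_add, min_comm (g w), ← max_sub_min_eq_abs']
  congr 1
  linarith [min_add_max (g v) (g w)]

lemma sum_mul_sq_add_sq_le (hA : A.IsSymm) {Δ : ℝ} (hΔ : ∀ v, rowSum A v ≤ Δ) (g : V → ℝ) :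
    ∑ v, ∑ w, A v w * (g v ^ 2 + g w ^ 2) ≤ 2 * Δ * ∑ v, g v ^ 2 := by
  simp only [mul_add, Finset.sum_add_distrib]
  rw [sum_mul_swap hA fun v _ => g v ^ 2, ← two_mul, mul_assoc]
  gcongr
  simp only [← Finset.sum_mul, Finset.mul_sum]
  gcongr with v
  exact hΔ v

variable [DecidableEq V]

/-- The total weight of the edges between `T` and its complement. -/
def cut (A : Matrix V V ℝ) (T : Finset V) : ℝ := ∑ v ∈ T, ∑ w ∈ Tᶜ, A v w

lemma cut_superlevel (A : Matrix V V ℝ) (g : V → ℝ) (t : ℝ) :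
    cut A (Finset.univ.filter fun v => t ≤ g v) =
      ∑ v, ∑ w, A v w * (Set.indicator (Set.Iic (g v)) 1 t -
        Set.indicator (Set.Iic (min (g v) (g w))) 1 t) := by
  simp only [cut, Finset.compl_filter, Finset.sum_filter]
  refine Finset.sum_congr rfl fun v _ => ?_
  by_cases hv : t ≤ g v
  · rw [if_pos hv]
    refine Finset.sum_congr rfl fun w _ => ?_
    by_cases hw : t ≤ g w <;> simp [hv, hw]
  · simp [hv]

lemma integrableOn_cut_superlevel (A : Matrix V V ℝ) (g : V → ℝ) (R : ℝ) :
    IntegrableOn (fun t => cut A (Finset.univ.filter fun v => t ≤ g v)) (Set.Ioc 0 R) := by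
  simp only [cut_superlevel]
  exact integrable_finsetSum _ fun v _ => integrable_finsetSum _ fun w _ =>
    integrableOn_const_mul_indicator_Iic_sub _ _ _ _

lemma setIntegral_cut_superlevel (A : Matrix V V ℝ) {g : V → ℝ} {R : ℝ} (hg : ∀ v, 0 ≤ g v)
    (hgR : ∀ v, g v ≤ R) :
    ∫ t in Set.Ioc 0 R, cut A (Finset.univ.filter fun v => t ≤ g v) =
      ∑ v, ∑ w, A v w * (g v - min (g v) (g w)) := by
  have hint (v w : V) := integrableOn_const_mul_indicator_Iic_sub (A v w) (g v) (min (g v) (g w)) R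
  simp only [cut_superlevel]
  rw [integral_finsetSum _ fun v _ => integrable_finsetSum _ fun w _ => hint v w]
  refine Finset.sum_congr rfl fun v _ => ?_
  rw [integral_finsetSum _ fun w _ => hint v w]
  refine Finset.sum_congr rfl fun w _ => ?_
  rw [integral_const_mul, integral_sub (integrableOn_indicator_Iic _ _)
      (integrableOn_indicator_Iic _ _), setIntegral_indicator_Iic (hg v) (hgR v),
    setIntegral_indicator_Iic (le_min (hg v) (hg w)) ((min_le_left _ _).trans (hgR v))]

/-- The `L¹` Sobolev inequality, from the coarea formula. -/
lemma mul_sum_le_of_le_cut (hA : A.IsSymm)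
    (hcut : ∀ T : Finset V, 2 * T.card ≤ Fintype.card V → κ * T.card ≤ cut A T) {g : V → ℝ}
    (hg : ∀ v, 0 ≤ g v)
    (hsupp : 2 * (Finset.univ.filter fun v => 0 < g v).card ≤ Fintype.card V) :
    κ * ∑ v, g v ≤ (∑ v, ∑ w, A v w * |g v - g w|) / 2 := by
  set R := ∑ u, g u
  have hgR (v : V) : g v ≤ R := Finset.single_le_sum (fun u _ => hg u) (Finset.mem_univ v)
  have hcard (t : ℝ) : ((Finset.univ.filter fun v => t ≤ g v).card : ℝ) =
      ∑ v, Set.indicator (Set.Iic (g v)) 1 t := by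
    simp [Set.indicator_apply]
  have hint : IntegrableOn (fun t => ((Finset.univ.filter fun v => t ≤ g v).card : ℝ))
      (Set.Ioc 0 R) := by
    simp only [hcard]
    exact integrable_finsetSum _ fun v _ => integrableOn_indicator_Iic _ _
  calc κ * R = ∫ t in Set.Ioc 0 R, κ * (Finset.univ.filter fun v => t ≤ g v).card := by
        simp only [hcard]
        rw [integral_const_mul,
          integral_finsetSum _ fun v _ => integrableOn_indicator_Iic (g v) R]
        simp only [setIntegral_indicator_Iic (hg _) (hgR _), R]
    _ ≤ ∫ t in Set.Ioc 0 R, cut A (Finset.univ.filter fun v => t ≤ g v) := by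
        refine setIntegral_mono_on (hint.const_mul κ) (integrableOn_cut_superlevel A g R)
          measurableSet_Ioc fun t ht => hcut _ (le_trans ?_ hsupp)
        gcongr with v
        exact ht.1
    _ = (∑ v, ∑ w, A v w * |g v - g w|) / 2 := by
        rw [setIntegral_cut_superlevel A hg hgR, sum_mul_sub_min hA]

lemma abs_sq_sub_sq_le {a b s : ℝ} (ha : 0 ≤ a) (hb : 0 ≤ b) (hs : 0 < s) :
    |a ^ 2 - b ^ 2| ≤ s * (a - b) ^ 2 + (a ^ 2 + b ^ 2) / (2 * s) := by
  have hAMGM : |a - b| * (a + b) ≤ s * |a - b| ^ 2 + (a + b) ^ 2 / (4 * s) := by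
    have : s * |a - b| ^ 2 + (a + b) ^ 2 / (4 * s) - |a - b| * (a + b) =
        (2 * s * |a - b| - (a + b)) ^ 2 / (4 * s) := by
      field_simp
      ring
    linarith [show 0 ≤ (2 * s * |a - b| - (a + b)) ^ 2 / (4 * s) by positivity]
  calc |a ^ 2 - b ^ 2| = |a - b| * (a + b) := by
        rw [sq_sub_sq, abs_mul, abs_of_nonneg (add_nonneg ha hb), mul_comm]
    _ ≤ s * |a - b| ^ 2 + (a + b) ^ 2 / (4 * s) := hAMGM
    _ ≤ s * |a - b| ^ 2 + 2 * (a ^ 2 + b ^ 2) / (4 * s) := by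
        gcongr
        linarith [sq_nonneg (a - b)]
    _ = s * (a - b) ^ 2 + (a ^ 2 + b ^ 2) / (2 * s) := by
        rw [sq_abs]
        field_simp
        ring

lemma sq_mul_sum_sq_le_dirichletForm (hA : A.IsSymm) (hA0 : ∀ v w, 0 ≤ A v w) {Δ : ℝ}
    (hΔ : ∀ v, rowSum A v ≤ Δ) (hΔ0 : 0 < Δ) (hκ : 0 < κ)
    (hcut : ∀ T : Finset V, 2 * T.card ≤ Fintype.card V → κ * T.card ≤ cut A T) {g : V → ℝ}
    (hg : ∀ v, 0 ≤ g v)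
    (hsupp : 2 * (Finset.univ.filter fun v => 0 < g v).card ≤ Fintype.card V) :
    κ ^ 2 * ∑ v, g v ^ 2 ≤ 2 * Δ * dirichletForm A g := by
  have hsupp' : 2 * (Finset.univ.filter fun v => 0 < g v ^ 2).card ≤ Fintype.card V := by
    simpa only [pow_pos_iff two_ne_zero, sq_pos_iff, (hg _).lt_iff_ne', ne_eq] using hsupp
  have hL1 : κ * ∑ v, g v ^ 2 ≤ Δ / κ * dirichletForm A g + κ / 2 * ∑ v, g v ^ 2 := by
    calc κ * ∑ v, g v ^ 2
        ≤ (∑ v, ∑ w, A v w * |g v ^ 2 - g w ^ 2|) / 2 :=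
          mul_sum_le_of_le_cut hA hcut (fun v => sq_nonneg _) hsupp'
      _ ≤ (∑ v, ∑ w, A v w *
            (Δ / κ * (g v - g w) ^ 2 + (g v ^ 2 + g w ^ 2) / (2 * (Δ / κ)))) / 2 := by
          gcongr with v _ w
          · exact hA0 v w
          · exact abs_sq_sub_sq_le (hg v) (hg w) (by positivity)
      _ = Δ / κ * dirichletForm A g +
            (∑ v, ∑ w, A v w * (g v ^ 2 + g w ^ 2)) / (4 * (Δ / κ)) := by
          simp only [dirichletForm, mul_add, mul_left_comm _ (Δ / κ), ← mul_div_assoc,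
            Finset.sum_add_distrib, ← Finset.mul_sum, ← Finset.sum_div]
          field_simp
          ring
      _ ≤ Δ / κ * dirichletForm A g + 2 * Δ * (∑ v, g v ^ 2) / (4 * (Δ / κ)) := by
          gcongr
          exact sum_mul_sq_add_sq_le hA hΔ g
      _ = Δ / κ * dirichletForm A g + κ / 2 * ∑ v, g v ^ 2 := by
          field_simp
          ring
  calc κ ^ 2 * ∑ v, g v ^ 2 = 2 * κ * (κ * ∑ v, g v ^ 2 - κ / 2 * ∑ v, g v ^ 2) := by ring
    _ ≤ 2 * κ * (Δ / κ * dirichletForm A g) := by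
        gcongr
        linarith
    _ = 2 * Δ * dirichletForm A g := by field_simp

lemma posPart_mul_negPart_eq_zero (a : ℝ) : a⁺ * a⁻ = 0 := by
  obtain ha | ha := le_total 0 a <;> simp [ha]

lemma sq_posPart_sub_add_sq_negPart_sub_le (a b : ℝ) :
    (a⁺ - b⁺) ^ 2 + (a⁻ - b⁻) ^ 2 ≤ (a - b) ^ 2 := by
  nth_rw 3 [← posPart_sub_negPart a, ← posPart_sub_negPart b]
  have ha : a⁺ * a⁻ = 0 := posPart_mul_negPart_eq_zero a
  have hb : b⁺ * b⁻ = 0 := posPart_mul_negPart_eq_zero b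
  linarith [mul_nonneg (posPart_nonneg a) (negPart_nonneg b),
    mul_nonneg (posPart_nonneg b) (negPart_nonneg a)]

/-- Cheeger's inequality. -/
theorem poincare_of_le_cut (hA : A.IsSymm) (hA0 : ∀ v w, 0 ≤ A v w) {Δ : ℝ}
    (hΔ : ∀ v, rowSum A v ≤ Δ) (hΔ0 : 0 < Δ) (hκ : 0 < κ)
    (hcut : ∀ T : Finset V, 2 * T.card ≤ Fintype.card V → κ * T.card ≤ cut A T) :
    Poincare A (κ ^ 2 / (2 * Δ)) := by
  intro f
  obtain _ | _ := isEmpty_or_nonempty V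
  · exact ⟨0, by simp [dirichletForm]⟩
  obtain ⟨m, hm, hm'⟩ := exists_median f
  refine ⟨m, ?_⟩
  have hpos := sq_mul_sum_sq_le_dirichletForm hA hA0 hΔ hΔ0 hκ hcut (g := fun v => (f v - m)⁺)
    (fun v => posPart_nonneg _) (by simpa only [posPart_pos_iff, sub_pos] using hm)
  have hneg := sq_mul_sum_sq_le_dirichletForm hA hA0 hΔ hΔ0 hκ hcut (g := fun v => (f v - m)⁻)
    (fun v => negPart_nonneg _) (by simpa only [negPart_pos_iff, sub_neg] using hm')
  have hsq (v : V) : (f v - m) ^ 2 = (f v - m)⁺ ^ 2 + (f v - m)⁻ ^ 2 := by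
    nth_rw 1 [← posPart_sub_negPart (f v - m)]
    linarith [posPart_mul_negPart_eq_zero (f v - m)]
  have hE : dirichletForm A (fun v => (f v - m)⁺) + dirichletForm A (fun v => (f v - m)⁻) ≤
      dirichletForm A f := by
    simp only [dirichletForm, ← add_div, ← Finset.sum_add_distrib, ← mul_add]
    gcongr with v _ w
    · exact hA0 v w
    · simpa using sq_posPart_sub_add_sq_negPart_sub_le (f v - m) (f w - m)
  rw [div_mul_eq_mul_div, div_le_iff₀ (by positivity)]
  simp only [hsq, Finset.sum_add_distrib]
  linarith [mul_le_mul_of_nonneg_left hE (mul_nonneg zero_le_two hΔ0.le)]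

end Cheeger

/-! ### Expected hitting times of the random walk -/

section TrajMeasure

variable {X : ℕ → Type*} [∀ n, MeasurableSpace (X n)]
  (κ : ∀ n, Kernel (∀ i : Finset.Iic n, X i) (X (n + 1))) [∀ n, IsMarkovKernel (κ n)]
  (μ₀ : Measure (X 0))

lemma lintegral_trajMeasure_zero {f : X 0 → ℝ≥0∞} (hf : Measurable f) :
    ∫⁻ x, f (x 0) ∂(Kernel.trajMeasure μ₀ κ) = ∫⁻ x, f x ∂μ₀ := by
  have hmap : (Kernel.trajMeasure μ₀ κ).map (Preorder.frestrictLe 0) =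
      μ₀.map (MeasurableEquiv.piUnique fun i : Finset.Iic 0 => X i).symm := by
    rw [Kernel.trajMeasure, Measure.map_comp _ _ (by fun_prop), Kernel.traj_map_frestrictLe,
      Kernel.partialTraj_self]
    exact Measure.id_comp
  have hf0 : Measurable fun y : ∀ i : Finset.Iic 0, X i => f (y ⟨0, Finset.mem_Iic.2 le_rfl⟩) :=
    hf.comp (measurable_pi_apply _)
  calc ∫⁻ x, f (x 0) ∂(Kernel.trajMeasure μ₀ κ)
      = ∫⁻ y, f (y ⟨0, _⟩) ∂((Kernel.trajMeasure μ₀ κ).map (Preorder.frestrictLe 0)) :=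
        (lintegral_map hf0 (Preorder.measurable_frestrictLe 0)).symm
    _ = ∫⁻ x, f x ∂μ₀ := by
        rw [hmap]
        exact lintegral_map hf0 (MeasurableEquiv.measurable _)

lemma lintegral_trajMeasure_succ [IsProbabilityMeasure μ₀] (n : ℕ)
    {F : (∀ i : Finset.Iic n, X i) → ℝ≥0∞}
    (hF : Measurable F) {f : X (n + 1) → ℝ≥0∞} (hf : Measurable f) :
    ∫⁻ x, F (Preorder.frestrictLe n x) * f (x (n + 1)) ∂(Kernel.trajMeasure μ₀ κ) =
      ∫⁻ x, F (Preorder.frestrictLe n x) * ∫⁻ y, f y ∂(κ n (Preorder.frestrictLe n x))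
        ∂(Kernel.trajMeasure μ₀ κ) := by
  have hFf : Measurable fun z : (∀ i : Finset.Iic n, X i) × X (n + 1) => F z.1 * f z.2 := by
    fun_prop
  calc ∫⁻ x, F (Preorder.frestrictLe n x) * f (x (n + 1)) ∂(Kernel.trajMeasure μ₀ κ)
      = ∫⁻ z, F z.1 * f z.2
          ∂((Kernel.trajMeasure μ₀ κ).map fun x => (Preorder.frestrictLe n x, x (n + 1))) :=
        (lintegral_map hFf
          ((Preorder.measurable_frestrictLe n).prodMk (measurable_pi_apply (n + 1)))).symm
    _ = ∫⁻ y, ∫⁻ z, F y * f z ∂(κ n y)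
          ∂((Kernel.trajMeasure μ₀ κ).map (Preorder.frestrictLe n)) := by
        rw [← Kernel.map_frestrictLe_trajMeasure_compProd_eq_map_trajMeasure,
          Measure.lintegral_compProd hFf]
    _ = ∫⁻ y, F y * ∫⁻ z, f z ∂(κ n y)
          ∂((Kernel.trajMeasure μ₀ κ).map (Preorder.frestrictLe n)) := by
        simp only [lintegral_const_mul _ hf]
    _ = ∫⁻ x, F (Preorder.frestrictLe n x) * ∫⁻ y, f y ∂(κ n (Preorder.frestrictLe n x))
          ∂(Kernel.trajMeasure μ₀ κ) :=
        lintegral_map (hF.mul hf.lintegral_kernel) (Preorder.measurable_frestrictLe n)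

end TrajMeasure

section Walk

variable {N : ℕ} (G : LoopGraph N) {v w : Fin N} {c : ℝ}

lemma lintegral_stepKernel (v : Fin N) (f : Fin N → ℝ≥0∞) :
    ∫⁻ u, f u ∂(stepKernel G v) = ∑ u, stepPMF G v u * f u := by
  rw [show stepKernel G v = (stepPMF G v).toMeasure from rfl, lintegral_fintype]
  refine Finset.sum_congr rfl fun u _ => ?_
  rw [PMF.toMeasure_apply_singleton _ _ (measurableSet_singleton u), mul_comm]

/-- The transition operator of simple random walk killed at `w`. -/
def killedStep (w : Fin N) (f : Fin N → ℝ≥0∞) (v : Fin N) : ℝ≥0∞ :=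
  ∑ u, stepPMF G v u * if u = w then 0 else f u

lemma lintegral_walkLaw_killed (v w : Fin N) (t : ℕ) (f : Fin N → ℝ≥0∞) :
    ∫⁻ x, (∏ i ∈ Finset.Iic t, if x i = w then 0 else 1) * f (x t) ∂(walkLaw G v) =
      if v = w then 0 else (killedStep G w)^[t] f v := by
  induction t generalizing f with
  | zero =>
    have hIic : Finset.Iic 0 = {0} := rfl
    have hzero := lintegral_trajMeasure_zero (X := fun _ => Fin N) (historyKernel G)
      (.dirac v) (measurable_of_countable fun u => (if u = w then 0 else 1) * f u)
    simp only [hIic, Finset.prod_singleton]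
    rw [walkLaw, hzero, lintegral_dirac]
    split_ifs <;> simp
  | succ t ih =>
    have hsucc := lintegral_trajMeasure_succ (X := fun _ => Fin N) (historyKernel G) (.dirac v) t
      (measurable_of_countable fun y => ∏ i : Finset.Iic t, if y i = w then 0 else 1)
      (measurable_of_countable fun u => if u = w then 0 else f u)
    have hprod (x : ℕ → Fin N) :
        (∏ i : Finset.Iic t, if Preorder.frestrictLe (π := fun _ => Fin N) t x i = w
          then (0 : ℝ≥0∞) else 1) = ∏ i ∈ Finset.Iic t, if x i = w then 0 else 1 :=
      Finset.prod_coe_sort (Finset.Iic t) fun i => if x i = w then (0 : ℝ≥0∞) else 1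
    simp only [hprod] at hsucc
    calc ∫⁻ x, (∏ i ∈ Finset.Iic (t + 1), if x i = w then 0 else 1) * f (x (t + 1)) ∂(walkLaw G v)
        = ∫⁻ x, (∏ i ∈ Finset.Iic t, if x i = w then 0 else 1) *
            (if x (t + 1) = w then 0 else f (x (t + 1))) ∂(walkLaw G v) := by
          refine lintegral_congr fun x => ?_
          rw [← Nat.range_succ_eq_Iic, Finset.prod_range_succ, mul_assoc, Nat.range_succ_eq_Iic]
          split_ifs <;> simp
      _ = ∫⁻ x, (∏ i ∈ Finset.Iic t, if x i = w then 0 else 1) * killedStep G w f (x t)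
            ∂(walkLaw G v) :=
          hsucc.trans (lintegral_congr fun x => by
            rw [killedStep, ← lintegral_stepKernel]
            rfl)
      _ = if v = w then 0 else (killedStep G w)^[t + 1] f v := by
          rw [ih, Function.iterate_succ_apply]

lemma toENNReal_eq_tsum (n : ℕ∞) : (n : ℝ≥0∞) = ∑' t : ℕ, if (t : ℕ∞) < n then 1 else 0 := by
  induction n using ENat.recTopCoe with
  | top => simp
  | coe n =>
    rw [tsum_eq_sum (s := Finset.range n) (by simp), Finset.sum_congr rfl fun t ht => by
      rw [if_pos (ENat.natCast_lt_natCast.2 (Finset.mem_range.1 ht))]]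
    simp

lemma lt_hittingTime_iff (w : Fin N) (x : ℕ → Fin N) (t : ℕ) :
    (t : ℕ∞) < hittingTime w x ↔ ∀ i ∈ Finset.Iic t, x i ≠ w := by
  rw [← not_iff_not, not_lt]
  refine hittingAfter_le_iff.trans ?_
  simp

lemma hittingTime_eq_tsum (w : Fin N) (x : ℕ → Fin N) :
    (hittingTime w x : ℝ≥0∞) = ∑' t : ℕ, ∏ i ∈ Finset.Iic t, if x i = w then 0 else 1 := by
  rw [toENNReal_eq_tsum]
  refine tsum_congr fun t => ?_
  simp only [lt_hittingTime_iff]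
  split_ifs with hx
  · exact (Finset.prod_eq_one fun i hi => if_neg (hx i hi)).symm
  · push Not at hx
    obtain ⟨i, hi, hxi⟩ := hx
    exact (Finset.prod_eq_zero hi (by rw [if_pos hxi])).symm

lemma expectedHittingTime_eq_tsum (v w : Fin N) :
    expectedHittingTime G v w = ∑' t : ℕ, if v = w then 0 else (killedStep G w)^[t] 1 v := by
  have hmeas (t : ℕ) : Measurable fun x : ℕ → Fin N =>
      ∏ i ∈ Finset.Iic t, if x i = w then (0 : ℝ≥0∞) else 1 :=
    Finset.measurable_prod _ fun i _ =>
      (measurable_of_countable fun u => if u = w then (0 : ℝ≥0∞) else 1).comp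
        (measurable_pi_apply i)
  simp only [expectedHittingTime, hittingTime_eq_tsum]
  rw [lintegral_tsum fun t => (hmeas t).aemeasurable]
  exact tsum_congr fun t => by simpa using lintegral_walkLaw_killed G v w t 1

lemma expectedHittingTime_self (w : Fin N) : expectedHittingTime G w w = 0 := by
  simp [expectedHittingTime_eq_tsum]

lemma expectedHittingTime_step (hvw : v ≠ w) :
    expectedHittingTime G v w = 1 + ∑ u, stepPMF G v u * expectedHittingTime G u w := by
  simp only [expectedHittingTime_eq_tsum, if_neg hvw]
  rw [tsum_eq_zero_add' ENNReal.summable]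
  congr 1
  simp only [Function.iterate_succ_apply', killedStep, ← ENNReal.tsum_mul_left]
  rw [Summable.tsum_finsetSum fun _ _ => ENNReal.summable]

/-- The expected hitting times are the smallest nonnegative solution of the recursion. -/
lemma expectedHittingTime_le {g : Fin N → ℝ≥0∞}
    (hg : ∀ v, v ≠ w → 1 + ∑ u, stepPMF G v u * g u ≤ g v) (v : Fin N) :
    expectedHittingTime G v w ≤ g v := by
  rw [expectedHittingTime_eq_tsum]
  refine ENNReal.tsum_le_of_sum_range_le fun T => ?_
  induction T generalizing v with
  | zero => simp
  | succ T ih =>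
    by_cases hvw : v = w
    · simp [hvw]
    calc ∑ t ∈ Finset.range (T + 1), (if v = w then 0 else (killedStep G w)^[t] 1 v)
        = 1 + ∑ u, stepPMF G v u *
            ∑ t ∈ Finset.range T, (if u = w then 0 else (killedStep G w)^[t] 1 u) := by
          simp only [Finset.sum_range_succ', if_neg hvw, Function.iterate_succ_apply', killedStep,
            Finset.mul_sum, Function.iterate_zero, id, Pi.one_apply]
          rw [Finset.sum_comm, add_comm]
      _ ≤ 1 + ∑ u, stepPMF G v u * g u := by
          gcongr with u
          exact ih u
      _ ≤ g v := hg v hvw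

/-- The adjacency matrix. -/
def adj : Matrix (Fin N) (Fin N) ℝ := fun v w => if G s(v, w) = true then 1 else 0

lemma adj_isSymm : (adj G).IsSymm := by
  ext v w
  rw [Matrix.transpose_apply, adj, adj, Sym2.eq_swap]

lemma adj_nonneg (v w : Fin N) : 0 ≤ adj G v w := by
  unfold adj
  split_ifs <;> simp

lemma adj_le_one (v w : Fin N) : adj G v w ≤ 1 := by
  unfold adj
  split_ifs <;> simp

lemma rowSum_adj (v : Fin N) : rowSum (adj G) v = degree G v := by
  simp [rowSum, adj, degree, neighbors]

variable {G}

lemma toReal_stepPMF (hv : 0 < degree G v) (u : Fin N) :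
    (stepPMF G v u).toReal = adj G v u / degree G v := by
  classical
  have hne : (neighbors G v).Nonempty := Finset.card_pos.1 hv
  rw [stepPMF, dif_pos hne, PMF.uniformOfFinset_apply, adj, neighbors, degree]
  by_cases huv : G s(v, u) = true <;> simp [huv, neighbors]

lemma toReal_sum_stepPMF_mul (hv : 0 < degree G v) {g : Fin N → ℝ≥0∞} (hg : ∀ u, g u ≠ ∞) :
    (∑ u, stepPMF G v u * g u).toReal = (adj G *ᵥ fun u => (g u).toReal) v / degree G v := by
  rw [ENNReal.toReal_sum fun u _ => ENNReal.mul_ne_top (PMF.apply_ne_top _ _) (hg u),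
    Matrix.mulVec, dotProduct, Finset.sum_div]
  refine Finset.sum_congr rfl fun u _ => ?_
  rw [ENNReal.toReal_mul, toReal_stepPMF hv, div_mul_eq_mul_div]

lemma laplacian_adj_mulVec_eq_iff (hv : 0 < degree G v) (f : Fin N → ℝ) :
    (laplacian (adj G) *ᵥ f) v = rowSum (adj G) v ↔ f v = 1 + (adj G *ᵥ f) v / degree G v := by
  have hd : (degree G v : ℝ) ≠ 0 := Nat.cast_ne_zero.2 hv.ne'
  rw [laplacian_mulVec, Pi.sub_apply, Pi.mul_apply, rowSum_adj, sub_eq_iff_eq_add,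
    one_add_div hd, eq_div_iff hd, mul_comm]

lemma expectedHittingTime_ne_top (hpos : ∀ v, 0 < degree G v) (hc : 0 < c)
    (hP : Poincare (adj G) c) (v w : Fin N) : expectedHittingTime G v w ≠ ∞ := by
  obtain ⟨h, hh⟩ := exists_isHittingPotential (adj_isSymm G) (adj_nonneg G) hP hc w
  have hh0 : ∀ v, 0 ≤ h v := hh.nonneg (adj_nonneg G) fun v => by
    rw [rowSum_adj]
    exact_mod_cast hpos v
  refine ne_top_of_le_ne_top (ENNReal.ofReal_ne_top (r := h v))
    (expectedHittingTime_le G (g := fun u => ENNReal.ofReal (h u)) (fun u hu => ?_) v)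
  have hsum := toReal_sum_stepPMF_mul (hpos u) fun u => ENNReal.ofReal_ne_top (r := h u)
  simp only [ENNReal.toReal_ofReal (hh0 _)] at hsum
  rw [(laplacian_adj_mulVec_eq_iff (hpos u) h).1 (hh.laplacian_eq u hu), ← hsum,
    ENNReal.ofReal_add zero_le_one ENNReal.toReal_nonneg, ENNReal.ofReal_one,
    ENNReal.ofReal_toReal (ENNReal.sum_ne_top.2 fun x _ =>
      ENNReal.mul_ne_top (PMF.apply_ne_top _ _) ENNReal.ofReal_ne_top)]

lemma isHittingPotential_expectedHittingTime (hpos : ∀ v, 0 < degree G v) (hc : 0 < c)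
    (hP : Poincare (adj G) c) (w : Fin N) :
    IsHittingPotential (adj G) w fun v => (expectedHittingTime G v w).toReal := by
  have hfin (v : Fin N) := expectedHittingTime_ne_top hpos hc hP v w
  refine ⟨by simp [expectedHittingTime_self], fun v hv => ?_⟩
  rw [laplacian_adj_mulVec_eq_iff (hpos v), ← toReal_sum_stepPMF_mul (hpos v) hfin,
    expectedHittingTime_step G hv, ENNReal.toReal_add ENNReal.one_ne_top
      (ENNReal.sum_ne_top.2 fun x _ => ENNReal.mul_ne_top (PMF.apply_ne_top _ _) (hfin x)),
    ENNReal.toReal_one]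

lemma stationary_ne_top (v : Fin N) : stationary G v ≠ ∞ := by
  by_cases hv : (degree G v : ℝ≥0∞) = 0
  · simp [stationary, hv]
  · exact ENNReal.div_ne_top (ENNReal.natCast_ne_top _) fun hsum =>
      hv ((Finset.sum_eq_zero_iff.1 hsum) v (Finset.mem_univ v))

lemma averageHittingTime_ne_top (hpos : ∀ v, 0 < degree G v) (hc : 0 < c)
    (hP : Poincare (adj G) c) (w : Fin N) : averageHittingTime G w ≠ ∞ :=
  ENNReal.sum_ne_top.2 fun v _ =>
    ENNReal.mul_ne_top (stationary_ne_top v) (expectedHittingTime_ne_top hpos hc hP v w)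

lemma toReal_averageHittingTime (hpos : ∀ v, 0 < degree G v) (hc : 0 < c)
    (hP : Poincare (adj G) c) (w : Fin N) :
    (averageHittingTime G w).toReal =
      stationaryMean (adj G) fun v => (expectedHittingTime G v w).toReal := by
  rw [averageHittingTime, ENNReal.toReal_sum fun v _ =>
    ENNReal.mul_ne_top (stationary_ne_top v) (expectedHittingTime_ne_top hpos hc hP v w),
    stationaryMean, dotProduct, Finset.sum_div]
  refine Finset.sum_congr rfl fun v _ => ?_
  rw [ENNReal.toReal_mul, stationary, ENNReal.toReal_div,
    ENNReal.toReal_sum fun _ _ => ENNReal.natCast_ne_top _]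
  simp only [ENNReal.toReal_natCast, rowSum_adj]
  ring

end Walk

/-! ### Chernoff bounds for independent Bernoulli variables -/

section Chernoff

variable {ι : Type*}

/-- The number of true coordinates of `ω` in `E`, as a real random variable. -/
def trueCount (E : Finset ι) (ω : ι → Bool) : ℝ := ∑ i ∈ E, if ω i = true then 1 else 0

variable [Fintype ι]

/-- The joint law of independent Boolean variables, the `i`-th one being true with
probability `p i`. -/
abbrev bernoulliPi (p : ι → I) : Measure (ι → Bool) :=
  Measure.pi fun i => bernoulliMeasure true false (p i)

variable (p : ι → I) (E : Finset ι)

lemma mgf_trueCount (t : ℝ) :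
    mgf (trueCount E) (bernoulliPi p) t = ∏ i ∈ E, (1 + (Real.exp t - 1) * (p i : ℝ)) := by
  classical
  have hexp (ω : ι → Bool) : Real.exp (t * trueCount E ω) =
      ∏ i, if i ∈ E then (if ω i = true then Real.exp t else 1) else 1 := by
    rw [trueCount, Finset.mul_sum, Real.exp_sum, Finset.prod_ite_mem, Finset.univ_inter]
    refine Finset.prod_congr rfl fun i _ => ?_
    split_ifs <;> simp
  calc
    _ = ∏ i, ∫ b, (if i ∈ E then (if b = true then Real.exp t else 1) else 1)
          ∂bernoulliMeasure true false (p i) := by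
      simp only [mgf, hexp]
      exact integral_fintype_prod_eq_prod
        fun i (b : Bool) => if i ∈ E then (if b = true then Real.exp t else 1) else 1
    _ = ∏ i, if i ∈ E then 1 + (Real.exp t - 1) * (p i : ℝ) else 1 := by
      refine Finset.prod_congr rfl fun i _ => ?_
      rw [integral_bernoulliMeasure]
      by_cases hi : i ∈ E
      · simp only [hi, ↓reduceIte, smul_eq_mul, Bool.false_eq_true, mul_one]
        ring
      · simp [hi]
    _ = _ := by rw [Finset.prod_ite_mem, Finset.univ_inter]

lemma mgf_trueCount_le (t : ℝ) :
    mgf (trueCount E) (bernoulliPi p) t ≤ Real.exp ((Real.exp t - 1) * ∑ i ∈ E, (p i : ℝ)) := by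
  rw [mgf_trueCount, Finset.mul_sum, Real.exp_sum]
  refine Finset.prod_le_prod (fun i _ => ?_) fun i _ => ?_
  · nlinarith [Real.exp_pos t, (p i).2.1, (p i).2.2]
  · rw [add_comm]
    exact Real.add_one_le_exp _

variable {δ : ℝ}

lemma measure_one_add_mul_le_trueCount_le (hδ0 : 0 ≤ δ) (hδ1 : δ ≤ 1) :
    (bernoulliPi p).real {ω | (1 + δ) * ∑ i ∈ E, (p i : ℝ) ≤ trueCount E ω} ≤
      Real.exp (-((∑ i ∈ E, (p i : ℝ)) * δ ^ 2 / 4)) := by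
  have hμ : 0 ≤ ∑ i ∈ E, (p i : ℝ) := Finset.sum_nonneg fun i _ => (p i).2.1
  have hexp : Real.exp (δ / 2) - 1 - δ / 2 ≤ (δ / 2) ^ 2 :=
    (abs_le.1 (Real.abs_exp_sub_one_sub_id_le (abs_le.2 ⟨by linarith, by linarith⟩))).2
  refine (measure_ge_le_exp_mul_mgf (t := δ / 2) _ (by linarith) .of_finite).trans
    ((mul_le_mul_of_nonneg_left (mgf_trueCount_le p E _) (Real.exp_pos _).le).trans ?_)
  rw [← Real.exp_add, Real.exp_le_exp]
  linarith [mul_le_mul_of_nonneg_right hexp hμ]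

lemma measure_trueCount_le_one_sub_mul_le (hδ0 : 0 ≤ δ) (hδ1 : δ ≤ 1) :
    (bernoulliPi p).real {ω | trueCount E ω ≤ (1 - δ) * ∑ i ∈ E, (p i : ℝ)} ≤
      Real.exp (-((∑ i ∈ E, (p i : ℝ)) * δ ^ 2 / 4)) := by
  have hμ : 0 ≤ ∑ i ∈ E, (p i : ℝ) := Finset.sum_nonneg fun i _ => (p i).2.1
  have hexp : Real.exp (-(δ / 2)) - 1 - -(δ / 2) ≤ (-(δ / 2)) ^ 2 :=
    (abs_le.1 (Real.abs_exp_sub_one_sub_id_le (abs_le.2 ⟨by linarith, by linarith⟩))).2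
  refine (measure_le_le_exp_mul_mgf (t := -(δ / 2)) _ (by linarith) .of_finite).trans
    ((mul_le_mul_of_nonneg_left (mgf_trueCount_le p E _) (Real.exp_pos _).le).trans ?_)
  rw [← Real.exp_add, Real.exp_le_exp]
  linarith [mul_le_mul_of_nonneg_right hexp hμ]

lemma measure_mul_lt_abs_trueCount_sub_le (hδ0 : 0 ≤ δ) (hδ1 : δ ≤ 1) :
    (bernoulliPi p).real
        {ω | δ * ∑ i ∈ E, (p i : ℝ) < |trueCount E ω - ∑ i ∈ E, (p i : ℝ)|} ≤
      2 * Real.exp (-((∑ i ∈ E, (p i : ℝ)) * δ ^ 2 / 4)) := by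
  rw [two_mul]
  refine (measureReal_mono fun ω hω => ?_).trans <| (measureReal_union_le _ _).trans <|
    add_le_add (measure_one_add_mul_le_trueCount_le p E hδ0 hδ1)
      (measure_trueCount_le_one_sub_mul_le p E hδ0 hδ1)
  simp only [Set.mem_union, Set.mem_ofPred_eq, lt_abs] at hω ⊢
  rcases hω with h | h
  · left; linarith
  · right; linarith

end Chernoff

/-! ### Degrees and cuts in the block model -/

section Pairs

variable {α β : Type*}

lemma sq_card_le_card_mul_card_filter_eq [Fintype β] [DecidableEq β] (f : α → β) (T : Finset α) :
    T.card ^ 2 ≤ Fintype.card β * ((T ×ˢ T).filter fun z => f z.1 = f z.2).card := by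
  have hT : T.card = ∑ b, (T.filter fun v => f v = b).card :=
    Finset.card_eq_sum_card_fiberwise fun _ _ => Finset.mem_univ _
  have hpairs : ((T ×ˢ T).filter fun z => f z.1 = f z.2).card =
      ∑ b, (T.filter fun v => f v = b).card ^ 2 := by
    rw [Finset.card_eq_sum_card_fiberwise (f := fun z => f z.1) (t := Finset.univ)
      fun _ _ => Finset.mem_univ _]
    refine Finset.sum_congr rfl fun b _ => ?_
    rw [sq, ← Finset.card_product]
    congr 1
    ext z
    simp only [Finset.mem_filter, Finset.mem_product]
    grind
  rw [hT, hpairs]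
  exact sq_sum_le_card_mul_sum_sq

variable [DecidableEq α]

/-- The unordered pairs underlying a set of ordered pairs. -/
def unorderedPairs (Q : Finset (α × α)) : Finset (Sym2 α) := Q.image fun z => s(z.1, z.2)

lemma sum_unorderedPairs_singleton_product (v : α) (U : Finset α) (F : Sym2 α → ℝ) :
    ∑ e ∈ unorderedPairs ({v} ×ˢ U), F e = ∑ w ∈ U, F s(v, w) := by
  rw [unorderedPairs, Finset.sum_image, Finset.sum_product, Finset.sum_singleton]
  rintro ⟨a, b⟩ hab ⟨c, d⟩ hcd h
  simp only [Finset.coe_product, Finset.coe_singleton, Set.mem_prod, Set.mem_singleton_iff]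
    at hab hcd
  obtain ⟨rfl, -⟩ := hab
  obtain ⟨rfl, -⟩ := hcd
  exact Prod.ext rfl (Sym2.congr_right.1 h)

lemma sum_unorderedPairs_of_disjoint {T U : Finset α} (hTU : Disjoint T U)
    {Q : Finset (α × α)} (hQ : Q ⊆ T ×ˢ U) (F : Sym2 α → ℝ) :
    ∑ e ∈ unorderedPairs Q, F e = ∑ z ∈ Q, F s(z.1, z.2) := by
  rw [unorderedPairs, Finset.sum_image]
  rintro ⟨a, b⟩ hab ⟨c, d⟩ hcd h
  have hab := Finset.mem_product.1 (hQ hab)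
  have hcd := Finset.mem_product.1 (hQ hcd)
  rcases Sym2.eq_iff.1 h with ⟨hac, hbd⟩ | ⟨had, -⟩
  · exact Prod.ext hac hbd
  · exact absurd (had ▸ hab.1) (Finset.disjoint_right.1 hTU hcd.2)

end Pairs

namespace BlockModel

variable {N M : ℕ} (S : BlockModel N M) (G : LoopGraph N)

/-- The adjacency matrix of the graph formed by the edges between different blocks. -/
def crossAdj : Matrix (Fin N) (Fin N) ℝ :=
  fun v w => if S.block v = S.block w then 0 else adj G v w

/-- The expected number of neighbours that a vertex has outside its own block. -/
def crossDegree : ℝ := ((M : ℝ) - 1) * ((N : ℝ) / M) * (S.q : ℝ)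

/-- The pairs in `T ×ˢ U` whose entries belong to different blocks. -/
def crossPairs (T U : Finset (Fin N)) : Finset (Fin N × Fin N) :=
  (T ×ˢ U).filter fun z => S.block z.1 ≠ S.block z.2

instance : IsProbabilityMeasure S.graphLaw := by
  unfold graphLaw
  infer_instance

lemma crossAdj_isSymm : (S.crossAdj G).IsSymm := by
  ext v w
  simp only [Matrix.transpose_apply, crossAdj, (adj_isSymm G).apply v w, eq_comm]

lemma crossAdj_nonneg (v w : Fin N) : 0 ≤ S.crossAdj G v w := by
  unfold crossAdj
  split_ifs
  exacts [le_rfl, adj_nonneg G v w]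

lemma crossAdj_le_adj (v w : Fin N) : S.crossAdj G v w ≤ adj G v w := by
  unfold crossAdj
  split_ifs
  exacts [adj_nonneg G v w, le_rfl]

lemma trueCount_unorderedPairs_univ (v : Fin N) :
    trueCount (unorderedPairs ({v} ×ˢ Finset.univ)) G = degree G v := by
  rw [trueCount, sum_unorderedPairs_singleton_product, ← rowSum_adj]
  rfl

lemma trueCount_unorderedPairs_ne_block (v : Fin N) :
    trueCount (unorderedPairs ({v} ×ˢ Finset.univ.filter fun w => S.block v ≠ S.block w)) G =
      rowSum (S.crossAdj G) v := by
  rw [trueCount, sum_unorderedPairs_singleton_product, Finset.sum_filter]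
  simp only [ite_not]
  rfl

lemma crossPairs_subset (T U : Finset (Fin N)) : S.crossPairs T U ⊆ T ×ˢ U :=
  Finset.filter_subset _ _

lemma trueCount_unorderedPairs_crossPairs_compl (T : Finset (Fin N)) :
    trueCount (unorderedPairs (S.crossPairs T Tᶜ)) G = cut (S.crossAdj G) T := by
  rw [trueCount, sum_unorderedPairs_of_disjoint disjoint_compl_right (S.crossPairs_subset _ _),
    crossPairs, Finset.sum_filter, Finset.sum_product]
  simp only [ite_not]
  rfl

lemma edgeProb_mk (v w : Fin N) :
    S.edgeProb s(v, w) = if S.block v = S.block w then S.p (S.block v) else S.q := rfl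

lemma card_block_eq_div (m : Fin M) :
    ((Finset.univ.filter fun v => S.block v = m).card : ℝ) = (N : ℝ) / M := by
  rw [eq_div_iff (by exact_mod_cast m.pos.ne'), mul_comm]
  exact_mod_cast S.card_block m

lemma card_ne_block (v : Fin N) :
    ((Finset.univ.filter fun w => S.block v ≠ S.block w).card : ℝ) = (M - 1) * (N / M : ℝ) := by
  have hM : (M : ℝ) ≠ 0 := by exact_mod_cast (S.block v).pos.ne'
  have hsplit := Finset.card_filter_add_card_filter_not (s := Finset.univ)
    fun w : Fin N => S.block w = S.block v
  have hsplit :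
      (N : ℝ) / M + ((Finset.univ.filter fun w => S.block w ≠ S.block v).card : ℝ) = N := by
    rw [← S.card_block_eq_div (S.block v)]
    exact_mod_cast hsplit.trans (by simp)
  simp only [ne_comm (a := S.block v)]
  field_simp at hsplit ⊢
  linarith

lemma sum_edgeProb_ne_block (v : Fin N) :
    ∑ w with S.block v ≠ S.block w, (S.edgeProb s(v, w) : ℝ) = S.crossDegree := by
  rw [crossDegree, ← S.card_ne_block v, ← nsmul_eq_mul, ← Finset.sum_const]
  refine Finset.sum_congr rfl fun w hw => ?_
  rw [edgeProb_mk, if_neg (Finset.mem_filter.1 hw).2]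

lemma γ_eq_add_crossDegree (m : Fin M) : S.γ m = (N : ℝ) / M * (S.p m : ℝ) + S.crossDegree := rfl

lemma sum_edgeProb (v : Fin N) : ∑ w, (S.edgeProb s(v, w) : ℝ) = S.γ (S.block v) := by
  rw [← Finset.sum_filter_add_sum_filter_not Finset.univ fun w => S.block v = S.block w,
    S.sum_edgeProb_ne_block, γ_eq_add_crossDegree, ← S.card_block_eq_div (S.block v),
    ← nsmul_eq_mul, ← Finset.sum_const]
  simp only [eq_comm (b := S.block v)]
  refine congrArg (· + _) (Finset.sum_congr rfl fun w hw => ?_)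
  rw [edgeProb_mk, if_pos (Finset.mem_filter.1 hw).2]

lemma card_crossPairs_univ (T : Finset (Fin N)) :
    ((S.crossPairs T Finset.univ).card : ℝ) = T.card * ((M - 1) * (N / M : ℝ)) := by
  rw [crossPairs, Finset.card_filter, Finset.sum_product, Nat.cast_sum, ← nsmul_eq_mul,
    ← Finset.sum_const]
  refine Finset.sum_congr rfl fun v _ => ?_
  rw [← Finset.card_filter, S.card_ne_block v]

lemma card_crossPairs_self_le (T : Finset (Fin N)) :
    M * ((S.crossPairs T T).card : ℝ) ≤ (M - 1) * (T.card : ℝ) ^ 2 := by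
  have hsplit := Finset.card_filter_add_card_filter_not (s := T ×ˢ T)
    fun z => S.block z.1 = S.block z.2
  have hsame := sq_card_le_card_mul_card_filter_eq S.block T
  rw [Finset.card_product] at hsplit
  rw [Fintype.card_fin] at hsame
  rify at hsplit hsame
  rw [crossPairs]
  nlinarith [mul_comm (M : ℝ)]

lemma card_crossPairs_compl (T : Finset (Fin N)) :
    (T.card : ℝ) * (N - T.card) * (M - 1) ≤ M * ((S.crossPairs T Tᶜ).card : ℝ) := by
  have hsplit : (S.crossPairs T T).card + (S.crossPairs T Tᶜ).card =
      (S.crossPairs T Finset.univ).card := by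
    simp only [crossPairs, Finset.card_filter, Finset.sum_product]
    rw [← Finset.sum_add_distrib]
    exact Finset.sum_congr rfl fun v _ => Finset.sum_add_sum_compl _ _
  have hself := S.card_crossPairs_self_le T
  have huniv : M * ((S.crossPairs T Finset.univ).card : ℝ) = T.card * (M - 1) * N := by
    rcases T.eq_empty_or_nonempty with rfl | ⟨v, -⟩
    · simp [crossPairs]
    · have hM : (M : ℝ) ≠ 0 := by exact_mod_cast (S.block v).pos.ne'
      rw [card_crossPairs_univ]
      field_simp
  rify at hsplit
  rw [← hsplit] at huniv
  linarith

lemma sum_edgeProb_crossPairs_compl (T : Finset (Fin N)) :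
    ∑ e ∈ unorderedPairs (S.crossPairs T Tᶜ), (S.edgeProb e : ℝ) =
      (S.crossPairs T Tᶜ).card * (S.q : ℝ) := by
  rw [sum_unorderedPairs_of_disjoint disjoint_compl_right (S.crossPairs_subset _ _)
    fun e => (S.edgeProb e : ℝ), ← nsmul_eq_mul, ← Finset.sum_const]
  refine Finset.sum_congr rfl fun z hz => ?_
  rw [edgeProb_mk, if_neg (Finset.mem_filter.1 hz).2]

lemma le_sum_edgeProb_crossPairs_compl {T : Finset (Fin N)} (hT : 2 * T.card ≤ N) :
    S.crossDegree * T.card / 2 ≤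
      ∑ e ∈ unorderedPairs (S.crossPairs T Tᶜ), (S.edgeProb e : ℝ) := by
  rw [sum_edgeProb_crossPairs_compl]
  rcases T.eq_empty_or_nonempty with rfl | ⟨v, -⟩
  · simp [crossPairs]
  have hM : (1 : ℝ) ≤ M := by exact_mod_cast (S.block v).pos
  have hT' : (N : ℝ) / 2 ≤ N - T.card := by
    have : 2 * (T.card : ℝ) ≤ N := by exact_mod_cast hT
    linarith
  calc S.crossDegree * T.card / 2
      = T.card * (N / 2) * (M - 1) / M * (S.q : ℝ) := by rw [crossDegree]; ring
    _ ≤ T.card * (N - T.card) * (M - 1) / M * (S.q : ℝ) := by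
      have := S.q.2.1
      have := sub_nonneg.2 hM
      gcongr
    _ ≤ (S.crossPairs T Tᶜ).card * (S.q : ℝ) := by
      refine mul_le_mul_of_nonneg_right ?_ S.q.2.1
      rw [div_le_iff₀ (by linarith), mul_comm _ (M : ℝ)]
      exact S.card_crossPairs_compl T

end BlockModel

/-! ### Typical graphs -/

section UnionBound

variable {Ω ι : Type*} {mΩ : MeasurableSpace Ω} {μ : Measure Ω} [Fintype ι]

lemma measureReal_exists_le {P : ι → Ω → Prop} {c : ℝ} (h : ∀ i, μ.real {ω | P i ω} ≤ c) :
    μ.real {ω | ∃ i, P i ω} ≤ Fintype.card ι * c := by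
  rw [Set.ofPred_exists, ← nsmul_eq_mul, ← Finset.card_univ, ← Finset.sum_const]
  exact (measureReal_iUnion_fintype_le _).trans (Finset.sum_le_sum fun i _ => h i)

lemma measureReal_exists_nonempty_le {P : Finset ι → Ω → Prop} {x : ℝ} (hx : 0 ≤ x)
    (h : ∀ T, μ.real {ω | P T ω} ≤ x ^ T.card) :
    μ.real {ω | ∃ T : Finset ι, T.Nonempty ∧ P T ω} ≤ Real.exp (Fintype.card ι * x) - 1 := by
  classical
  have hsum : ∑ T ∈ (Finset.univ : Finset (Finset ι)).erase ∅, x ^ T.card =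
      (x + 1) ^ Fintype.card ι - 1 := by
    rw [← Fintype.sum_pow_mul_eq_add_pow, Finset.sum_erase_eq_sub (Finset.mem_univ _)]
    simp
  have hevent : {ω | ∃ T : Finset ι, T.Nonempty ∧ P T ω} =
      ⋃ T ∈ (Finset.univ : Finset (Finset ι)).erase ∅, {ω | P T ω} := by
    ext ω
    simp [Finset.nonempty_iff_ne_empty]
  rw [hevent]
  refine (measureReal_biUnion_finset_le _ _).trans <|
    (Finset.sum_le_sum fun T _ => h T).trans ?_
  rw [hsum, Real.exp_nat_mul]
  gcongr
  exact Real.add_one_le_exp x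

end UnionBound

namespace BlockModel

variable {N M : ℕ} (S : BlockModel N M) {δ : ℝ}

/-- The properties of the random graph that determine the hitting times: every degree is close to
its expectation, and the edges between different blocks form an expander of bounded degree. -/
structure IsTypical (δ : ℝ) (G : LoopGraph N) : Prop where
  abs_degree_sub_le (v : Fin N) : |degree G v - S.γ (S.block v)| ≤ δ * S.γ (S.block v)
  rowSum_crossAdj_le (v : Fin N) : rowSum (S.crossAdj G) v ≤ 2 * S.crossDegree
  le_cut (T : Finset (Fin N)) (hT : 2 * T.card ≤ N) :
    S.crossDegree / 4 * T.card ≤ cut (S.crossAdj G) T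

lemma γmin_le (m : Fin M) : S.γmin ≤ S.γ m := ciInf_le (Set.finite_range _).bddBelow m

lemma le_γmax (m : Fin M) : S.γ m ≤ S.γmax := le_ciSup (Set.finite_range _).bddAbove m

lemma measure_mul_lt_abs_degree_sub_le (hδ0 : 0 ≤ δ) (hδ1 : δ ≤ 1) (v : Fin N) :
    S.graphLaw.real {G | δ * S.γ (S.block v) < |degree G v - S.γ (S.block v)|} ≤
      2 * Real.exp (-(S.γmin * δ ^ 2 / 4)) := by
  have htail := measure_mul_lt_abs_trueCount_sub_le S.edgeProb
    (unorderedPairs ({v} ×ˢ Finset.univ)) hδ0 hδ1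
  simp only [trueCount_unorderedPairs_univ, sum_unorderedPairs_singleton_product,
    sum_edgeProb] at htail
  refine htail.trans ?_
  gcongr
  exact S.γmin_le _

lemma measure_lt_rowSum_crossAdj_le (v : Fin N) :
    S.graphLaw.real {G | 2 * S.crossDegree < rowSum (S.crossAdj G) v} ≤
      Real.exp (-(S.crossDegree / 4)) := by
  have htail := measure_one_add_mul_le_trueCount_le S.edgeProb
    (unorderedPairs ({v} ×ˢ Finset.univ.filter fun w => S.block v ≠ S.block w))
    zero_le_one le_rfl
  simp only [trueCount_unorderedPairs_ne_block, sum_unorderedPairs_singleton_product,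
    sum_edgeProb_ne_block, one_pow, mul_one, one_add_one_eq_two] at htail
  refine (measureReal_mono fun G hG => ?_).trans htail
  simp only [Set.mem_ofPred_eq] at hG ⊢
  exact hG.le

lemma measure_cut_crossAdj_lt_le {T : Finset (Fin N)} (hT : 2 * T.card ≤ N) :
    S.graphLaw.real {G | cut (S.crossAdj G) T < S.crossDegree / 4 * T.card} ≤
      Real.exp (-(S.crossDegree / 32)) ^ T.card := by
  have hmean := S.le_sum_edgeProb_crossPairs_compl hT
  have htail := measure_trueCount_le_one_sub_mul_le S.edgeProb
    (unorderedPairs (S.crossPairs T Tᶜ)) (δ := 1 / 2) (by norm_num) (by norm_num)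
  simp only [trueCount_unorderedPairs_crossPairs_compl] at htail
  rw [← Real.exp_nat_mul]
  refine (measureReal_mono fun G hG => ?_).trans (htail.trans (Real.exp_le_exp.2 (by linarith)))
  simp only [Set.mem_ofPred_eq] at hG ⊢
  linarith

lemma measure_exists_cut_crossAdj_lt_le :
    S.graphLaw.real {G | ∃ T : Finset (Fin N), T.Nonempty ∧
        (2 * T.card ≤ N ∧ cut (S.crossAdj G) T < S.crossDegree / 4 * T.card)} ≤
      Real.exp (N * Real.exp (-(S.crossDegree / 32))) - 1 := by
  refine (measureReal_exists_nonempty_le (Real.exp_pos _).le fun T => ?_).trans_eq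
    (by rw [Fintype.card_fin])
  by_cases hT : 2 * T.card ≤ N
  · simpa only [hT, true_and] using S.measure_cut_crossAdj_lt_le hT
  · simp only [hT, false_and, Set.ofPred_false, measureReal_empty]
    positivity

lemma measure_not_isTypical_le (hδ0 : 0 ≤ δ) (hδ1 : δ ≤ 1) :
    S.graphLaw.real {G | ¬ S.IsTypical δ G} ≤
      N * (2 * Real.exp (-(S.γmin * δ ^ 2 / 4))) + N * Real.exp (-(S.crossDegree / 4)) +
        (Real.exp (N * Real.exp (-(S.crossDegree / 32))) - 1) := by
  have hdegree := measureReal_exists_le (S.measure_mul_lt_abs_degree_sub_le hδ0 hδ1)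
  have hrowSum := measureReal_exists_le S.measure_lt_rowSum_crossAdj_le
  rw [Fintype.card_fin] at hdegree hrowSum
  refine (measureReal_mono fun G hG => ?_).trans <| (measureReal_union_le _ _).trans <|
    add_le_add ((measureReal_union_le _ _).trans (add_le_add hdegree hrowSum))
      S.measure_exists_cut_crossAdj_lt_le
  contrapose! hG
  simp only [Set.mem_union, Set.mem_ofPred_eq, not_or, not_exists, not_lt, not_and] at hG
  obtain ⟨⟨hdeg, hrow⟩, hcut⟩ := hG
  refine not_not.2 ⟨hdeg, hrow, fun T hT => ?_⟩
  rcases T.eq_empty_or_nonempty with rfl | hne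
  · simp [cut]
  · exact hcut T hne hT

end BlockModel

/-! ### Hitting times of typical graphs -/

lemma abs_mul_div_sub_one_le {x r s δ : ℝ} (hδ : δ ≤ 1 / 2) (hx : |x - 1| ≤ δ)
    (hr : |r - 1| ≤ δ) (hs : |s - 1| ≤ δ) : |x * (r / s) - 1| ≤ 8 * δ := by
  have hs' : 1 / 2 ≤ s := by linarith [(abs_le.1 hs).1]
  have hδ0 : 0 ≤ δ := (abs_nonneg _).trans hx
  have hnum : |x * r - s| ≤ 4 * δ := by
    calc |x * r - s| = |(x - 1) * (r - 1) + (x - 1) + (r - 1) - (s - 1)| := by congr 1; ring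
      _ ≤ |x - 1| * |r - 1| + |x - 1| + |r - 1| + |s - 1| := by
        rw [← abs_mul]
        exact (abs_sub _ _).trans (by gcongr; exact abs_add_three _ _ _)
      _ ≤ δ * δ + δ + δ + δ := by gcongr
      _ ≤ 4 * δ := by nlinarith
  have hs0 : 0 < s := by linarith
  rw [show x * (r / s) - 1 = (x * r - s) / s by field_simp, abs_div, abs_of_pos hs0,
    div_le_iff₀ hs0]
  nlinarith

namespace BlockModel

variable {N M : ℕ} (S : BlockModel N M) {δ : ℝ} {G : LoopGraph N}

lemma crossDegree_nonneg : 0 ≤ S.crossDegree := by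
  rcases M.eq_zero_or_pos with rfl | hM
  · simp [crossDegree]
  · have : (1 : ℝ) ≤ M := by exact_mod_cast hM
    exact mul_nonneg (mul_nonneg (by linarith) (by positivity)) S.q.2.1

lemma crossDegree_le : S.crossDegree ≤ N := by
  rcases M.eq_zero_or_pos with rfl | hM
  · simp [crossDegree]
  have hM' : (1 : ℝ) ≤ M := by exact_mod_cast hM
  calc S.crossDegree ≤ ((M : ℝ) - 1) * ((N : ℝ) / M) * 1 :=
        mul_le_mul_of_nonneg_left S.q.2.2 (mul_nonneg (by linarith) (by positivity))
    _ ≤ M * ((N : ℝ) / M) * 1 := by gcongr; linarith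
    _ = N := by field_simp

lemma crossDegree_le_γ (m : Fin M) : S.crossDegree ≤ S.γ m := by
  rw [γ_eq_add_crossDegree, le_add_iff_nonneg_left]
  exact mul_nonneg (by positivity) (S.p m).2.1

lemma crossDegree_le_γmin : S.crossDegree ≤ S.γmin := by
  rcases M.eq_zero_or_pos with rfl | hM
  · simp [crossDegree, γmin]
  · have : Nonempty (Fin M) := ⟨⟨0, hM⟩⟩
    exact le_ciInf S.crossDegree_le_γ

lemma sum_γ_block : ∑ v, S.γ (S.block v) = (N : ℝ) / M * ∑ m, S.γ m := by
  rw [← Finset.sum_fiberwise (s := Finset.univ) (g := S.block), Finset.mul_sum]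
  refine Finset.sum_congr rfl fun m _ => ?_
  rw [← S.card_block_eq_div m, ← nsmul_eq_mul, ← Finset.sum_const]
  exact Finset.sum_congr rfl fun v hv => by rw [(Finset.mem_filter.1 hv).2]

variable {S}

namespace IsTypical

lemma poincare (hG : S.IsTypical δ G) (hy : 0 < S.crossDegree) :
    Poincare (adj G) (S.crossDegree / 64) := by
  have hcross : Poincare (S.crossAdj G)
      ((S.crossDegree / 4) ^ 2 / (2 * (2 * S.crossDegree))) :=
    poincare_of_le_cut (S.crossAdj_isSymm G) (S.crossAdj_nonneg G) hG.rowSum_crossAdj_le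
      (by positivity) (by positivity) fun T hT => hG.le_cut T (by rwa [Fintype.card_fin] at hT)
  convert hcross.mono (S.crossAdj_le_adj G) using 1
  field_simp
  norm_num

lemma half_γmin_le_degree (hG : S.IsTypical δ G) (hδ : δ ≤ 1 / 2) (hγ : 0 < S.γmin) (v : Fin N) :
    S.γmin / 2 ≤ degree G v := by
  have hle := S.γmin_le (S.block v)
  nlinarith [(abs_le.1 (hG.abs_degree_sub_le v)).1]

lemma degree_le_two_mul_γmax (hG : S.IsTypical δ G) (hδ : δ ≤ 1 / 2) (hγ : 0 < S.γmin)
    (v : Fin N) : degree G v ≤ 2 * S.γmax := by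
  have hle := S.γmin_le (S.block v)
  have hle' := S.le_γmax (S.block v)
  nlinarith [(abs_le.1 (hG.abs_degree_sub_le v)).2]

lemma abs_degree_div_sub_one_le (hG : S.IsTypical δ G) (hγ : 0 < S.γmin) (v : Fin N) :
    |degree G v / S.γ (S.block v) - 1| ≤ δ := by
  have hpos : 0 < S.γ (S.block v) := hγ.trans_le (S.γmin_le _)
  rw [div_sub_one hpos.ne', abs_div, abs_of_pos hpos, div_le_iff₀ hpos]
  exact hG.abs_degree_sub_le v

lemma abs_sum_degree_div_sub_one_le [Nonempty (Fin N)] (hG : S.IsTypical δ G)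
    (hγ : 0 < S.γmin) :
    |(∑ v, (degree G v : ℝ)) / (∑ v, S.γ (S.block v)) - 1| ≤ δ := by
  have hpos : 0 < ∑ v, S.γ (S.block v) :=
    Finset.sum_pos (fun v _ => hγ.trans_le (S.γmin_le _)) Finset.univ_nonempty
  rw [div_sub_one hpos.ne', abs_div, abs_of_pos hpos, div_le_iff₀ hpos,
    ← Finset.sum_sub_distrib, Finset.mul_sum]
  exact (Finset.abs_sum_le_sum_abs _ _).trans (Finset.sum_le_sum fun v _ => hG.abs_degree_sub_le v)

lemma degree_pos (hG : S.IsTypical δ G) (hδ : δ ≤ 1 / 2) (hγ : 0 < S.γmin) (v : Fin N) :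
    0 < degree G v := by
  have : (0 : ℝ) < degree G v := (half_pos hγ).trans_le (hG.half_γmin_le_degree hδ hγ v)
  exact_mod_cast this

lemma stationary_le (hG : S.IsTypical δ G) (hδ : δ ≤ 1 / 2) (hy : 0 < S.crossDegree)
    (w : Fin N) :
    degree G w / ∑ v, (degree G v : ℝ) ≤ 4 * (S.γmax / (S.crossDegree * S.γmin)) := by
  have hγ : 0 < S.γmin := hy.trans_le S.crossDegree_le_γmin
  have hγmax : 0 < S.γmax := hγ.trans_le ((S.γmin_le (S.block w)).trans (S.le_γmax _))
  have hsum : S.crossDegree * (S.γmin / 2) ≤ ∑ v, (degree G v : ℝ) :=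
    calc S.crossDegree * (S.γmin / 2) ≤ ∑ _v : Fin N, S.γmin / 2 := by
          rw [Finset.sum_const, Finset.card_univ, Fintype.card_fin, nsmul_eq_mul]
          gcongr
          exact S.crossDegree_le
      _ ≤ ∑ v, (degree G v : ℝ) := Finset.sum_le_sum fun v _ => hG.half_γmin_le_degree hδ hγ v
  calc degree G w / ∑ v, (degree G v : ℝ)
      ≤ 2 * S.γmax / (S.crossDegree * (S.γmin / 2)) :=
        div_le_div₀ (by positivity) (hG.degree_le_two_mul_γmax hδ hγ w) (by positivity) hsum
    _ = 4 * (S.γmax / (S.crossDegree * S.γmin)) := by field_simp; norm_num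

lemma abs_mul_averageHittingTime_sub_one_le (hG : S.IsTypical δ G) (hδ : δ ≤ 1 / 2)
    (hy : 0 < S.crossDegree) (w : Fin N) :
    |degree G w / (∑ v, (degree G v : ℝ)) * (averageHittingTime G w).toReal - 1| ≤
      266 * (S.γmax / (S.crossDegree * S.γmin)) := by
  have hγ : 0 < S.γmin := hy.trans_le S.crossDegree_le_γmin
  have hP := hG.poincare hy
  have hc : 0 < S.crossDegree / 64 := by positivity
  have hpos := hG.degree_pos hδ hγ
  have hH := isHittingPotential_expectedHittingTime hpos hc hP w
  have herror := hH.abs_mul_stationaryMean_sub_one_le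
    (adj_isSymm G) (adj_nonneg G) (adj_le_one G) hP hc (half_pos hγ)
    (fun v => (hG.half_γmin_le_degree hδ hγ v).trans_eq (rowSum_adj G v).symm)
    (fun v => (rowSum_adj G v).trans_le (hG.degree_le_two_mul_γmax hδ hγ v))
  rw [← toReal_averageHittingTime hpos hc hP] at herror
  simp only [rowSum_adj] at herror
  have hmin : 1 / (S.γmin / 2) ≤ 2 * (S.γmax / (S.crossDegree * S.γmin)) :=
    calc 1 / (S.γmin / 2) = 2 * (S.crossDegree / (S.crossDegree * S.γmin)) := by field_simp
      _ ≤ 2 * (S.γmax / (S.crossDegree * S.γmin)) := by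
        gcongr
        exact (S.crossDegree_le_γ (S.block w)).trans (S.le_γmax _)
  have hmax : 2 * S.γmax / (S.crossDegree / 64 * (S.γmin / 2)) =
      256 * (S.γmax / (S.crossDegree * S.γmin)) := by
    field_simp
    ring
  linarith [hG.stationary_le hδ hy w]

theorem abs_averageHittingTime_div_sub_one_le (hG : S.IsTypical δ G) (hδ : δ ≤ 1 / 2)
    (hy : 0 < S.crossDegree) (hγ : 266 * (S.γmax / (S.crossDegree * S.γmin)) ≤ δ) (w : Fin N) :
    averageHittingTime G w ≠ ∞ ∧
      |(averageHittingTime G w).toReal /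
        ((N : ℝ) / (M : ℝ) * ((∑ m, S.γ m) / S.γ (S.block w))) - 1| ≤ 8 * δ := by
  have hmin : 0 < S.γmin := hy.trans_le S.crossDegree_le_γmin
  have hpos := hG.degree_pos hδ hmin
  refine ⟨averageHittingTime_ne_top hpos (by positivity) (hG.poincare hy) w, ?_⟩
  have : Nonempty (Fin N) := ⟨w⟩
  have hx := (hG.abs_mul_averageHittingTime_sub_one_le hδ hy w).trans hγ
  convert abs_mul_div_sub_one_le hδ hx (hG.abs_sum_degree_div_sub_one_le hmin)
    (hG.abs_degree_div_sub_one_le hmin w) using 3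
  have hd : (degree G w : ℝ) ≠ 0 := by exact_mod_cast (hpos w).ne'
  have hD : ∑ v, (degree G v : ℝ) ≠ 0 := by
    exact_mod_cast (Finset.sum_pos (fun v _ => hpos v) Finset.univ_nonempty).ne'
  rw [← mul_div_assoc, ← sum_γ_block]
  field_simp

end IsTypical

end BlockModel

/-! ### Limits -/

lemma tendsto_natCast_mul_exp_neg {ι : Type*} {l : Filter ι} {N : ι → ℕ} {y : ι → ℝ}
    (hN : Tendsto N l atTop) (hlog : (fun k => Real.log (N k)) =o[l] y) (hy : ∀ k, 0 ≤ y k)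
    {κ : ℝ} (hκ : 0 < κ) : Tendsto (fun k => N k * Real.exp (-(κ * y k))) l (𝓝 0) := by
  refine squeeze_zero' (Eventually.of_forall fun k => by positivity) ?_
    (tendsto_one_div_atTop_nhds_zero_nat.comp hN)
  filter_upwards [hlog.def (half_pos hκ), hN.eventually_gt_atTop 0] with k hk hNk
  have hNk' : (0 : ℝ) < N k := by exact_mod_cast hNk
  rw [Real.norm_of_nonneg (Real.log_natCast_nonneg _), Real.norm_of_nonneg (hy k)] at hk
  calc N k * Real.exp (-(κ * y k)) = Real.exp (Real.log (N k) + -(κ * y k)) := by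
        rw [Real.exp_add, Real.exp_log hNk']
    _ ≤ Real.exp (-Real.log (N k)) := Real.exp_le_exp.2 (by linarith)
    _ = 1 / N k := by rw [Real.exp_neg, Real.exp_log hNk', one_div]

lemma add_le_mul_sq {c u y : ℝ} (hc : 0 < c) (hy : 0 ≤ y) (h2 : 2 ≤ u + y)
    (h4 : 4 / c ≤ u + y) (hu : 1 ≤ u → u ≤ c / 2 * y ^ 2) : u + y ≤ c * y ^ 2 := by
  rcases le_or_gt u y with huy | hyu
  · rw [div_le_iff₀ hc] at h4
    calc u + y ≤ 2 * y := by linarith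
      _ ≤ c * y ^ 2 := by nlinarith
  · linarith [hu (by linarith)]

lemma mul_le_mixed_rpow {s L p P : ℝ} (hs : 0 < s) (hL : 1 ≤ L) (hsp : s ≤ p) (hpP : p ≤ P) :
    s * p ≤ (s * L) ^ (1 / 4 : ℝ) * p ^ (5 / 4 : ℝ) * P ^ (1 / 2 : ℝ) := by
  have hp : 0 < p := hs.trans_le hsp
  have hsL : s ^ (1 / 4 : ℝ) ≤ (s * L) ^ (1 / 4 : ℝ) :=
    Real.rpow_le_rpow hs.le (le_mul_of_one_le_right hs.le hL) (by norm_num)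
  have hps : p * s ^ (1 / 4 : ℝ) ≤ p ^ (5 / 4 : ℝ) := by
    rw [show (5 / 4 : ℝ) = 1 + 1 / 4 by norm_num, Real.rpow_add hp, Real.rpow_one]
    gcongr
  have hsP : s ^ (1 / 2 : ℝ) ≤ P ^ (1 / 2 : ℝ) :=
    Real.rpow_le_rpow hs.le (hsp.trans hpP) (by norm_num)
  have hs1 : s ^ (1 / 4 : ℝ) * s ^ (1 / 4 : ℝ) * s ^ (1 / 2 : ℝ) = s := by
    rw [← Real.rpow_add hs, ← Real.rpow_add hs]
    norm_num
  calc s * p = (s ^ (1 / 4 : ℝ) * s ^ (1 / 4 : ℝ) * s ^ (1 / 2 : ℝ)) * p := by rw [hs1]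
    _ = s ^ (1 / 4 : ℝ) * (p * s ^ (1 / 4 : ℝ)) * s ^ (1 / 2 : ℝ) := by ring
    _ ≤ _ := by gcongr

namespace BlockModel

variable {N M : ℕ} (S : BlockModel N M)

lemma γmin_le_γmax : S.γmin ≤ S.γmax := by
  rcases M.eq_zero_or_pos with rfl | hM
  · simp [γmin, γmax]
  · exact (S.γmin_le ⟨0, hM⟩).trans (S.le_γmax _)

lemma γmin_eq : S.γmin = (N : ℝ) / M * S.pmin + S.crossDegree := by
  rcases M.eq_zero_or_pos with rfl | hM
  · simp [γmin, crossDegree]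
  · have : Nonempty (Fin M) := ⟨⟨0, hM⟩⟩
    simp only [γmin, γ_eq_add_crossDegree, pmin]
    rw [Real.mul_iInf_of_nonneg (by positivity), ciInf_add (Set.finite_range _).bddBelow]

lemma pmin_le_pmax : S.pmin ≤ S.pmax := by
  rcases M.eq_zero_or_pos with rfl | hM
  · simp [pmin, pmax]
  · exact (ciInf_le (f := fun m => (S.p m : ℝ)) (Set.finite_range _).bddBelow ⟨0, hM⟩).trans
      (le_ciSup (f := fun m => (S.p m : ℝ)) (Set.finite_range _).bddAbove ⟨0, hM⟩)

lemma log_pow_mul_sq_div_le_iSup (hγ : 0 < S.γmin) :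
    Real.log N ^ 4 * S.γmax ^ 2 / S.γmin ^ 3 ≤
      ⨆ m : Fin M, (M : ℝ) * Real.log N ^ 4 /
        ((N : ℝ) * (S.p m : ℝ) + (N : ℝ) * ((M : ℝ) - 1) * (S.q : ℝ)) *
          (S.γmax ^ 2 / S.γmin ^ 2) := by
  have hM : 0 < M := by
    refine Nat.pos_of_ne_zero ?_
    rintro rfl
    simp [γmin] at hγ
  have : Nonempty (Fin M) := ⟨⟨0, hM⟩⟩
  obtain ⟨m, hm⟩ : ∃ m, S.γ m = S.γmin := exists_eq_ciInf_of_finite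
  refine le_ciSup_of_le (Set.finite_range _).bddAbove m (le_of_eq ?_)
  have hdeg : (N : ℝ) * (S.p m : ℝ) + (N : ℝ) * ((M : ℝ) - 1) * (S.q : ℝ) = M * S.γmin := by
    rw [← hm, γ]
    field_simp
  rw [hdeg]
  field_simp

lemma mul_pmin_le_mul_sq {c : ℝ} (hN : 0 < N) (hL : 1 ≤ Real.log N)
    (hc : ((M : ℝ) * Real.log N / N) ^ (1 / 4 : ℝ) * S.pmin ^ (5 / 4 : ℝ) * S.pmax ^ (1 / 2 : ℝ) ≤
      c * (((M : ℝ) - 1) * (S.q : ℝ)) ^ 2) (hp : 1 ≤ (N : ℝ) / M * S.pmin) :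
    (N : ℝ) / M * S.pmin ≤ c * S.crossDegree ^ 2 := by
  have hM : 0 < M := Fin.pos (S.block ⟨0, hN⟩)
  have hMN : (M : ℝ) / N ≤ S.pmin := by
    rw [div_le_iff₀ (by positivity)]
    rw [div_mul_eq_mul_div, le_div_iff₀ (by positivity)] at hp
    linarith
  have hmix := mul_le_mixed_rpow (by positivity) hL hMN S.pmin_le_pmax
  rw [div_mul_eq_mul_div _ _ (Real.log N)] at hmix
  calc (N : ℝ) / M * S.pmin = ((N : ℝ) / M) ^ 2 * ((M : ℝ) / N * S.pmin) := by field_simp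
    _ ≤ ((N : ℝ) / M) ^ 2 * (c * (((M : ℝ) - 1) * (S.q : ℝ)) ^ 2) :=
      mul_le_mul_of_nonneg_left (hmix.trans hc) (sq_nonneg _)
    _ = c * S.crossDegree ^ 2 := by rw [crossDegree]; ring

end BlockModel

section Asymptotics

variable {N M : ℕ → ℕ} {S : ∀ k, BlockModel (N k) (M k)}

lemma eventually_one_le_log (hN : Tendsto N atTop atTop) :
    ∀ᶠ k in atTop, 1 ≤ Real.log (N k) :=
  (Real.tendsto_log_atTop.comp (tendsto_natCast_atTop_atTop.comp hN)).eventually_ge_atTop 1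

lemma tendsto_measure_isTypical (hN : Tendsto N atTop atTop)
    (hlog : (fun k => Real.log (N k)) =o[atTop] fun k => (S k).crossDegree) {δ : ℝ} (hδ0 : 0 < δ)
    (hδ1 : δ ≤ 1) :
    Tendsto (fun k => (S k).graphLaw {G | (S k).IsTypical δ G}) atTop (𝓝 1) := by
  have hexp {κ : ℝ} (hκ : 0 < κ) :
      Tendsto (fun k => N k * Real.exp (-(κ * (S k).crossDegree))) atTop (𝓝 0) :=
    tendsto_natCast_mul_exp_neg hN hlog (fun k => (S k).crossDegree_nonneg) hκ
  have hlim : Tendsto (fun k =>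
      2 * (N k * Real.exp (-(δ ^ 2 / 4 * (S k).crossDegree))) +
        N k * Real.exp (-(1 / 4 * (S k).crossDegree)) +
        (Real.exp (N k * Real.exp (-(1 / 32 * (S k).crossDegree))) - 1)) atTop (𝓝 0) := by
    have hdeg := (hexp (κ := δ ^ 2 / 4) (by positivity)).const_mul 2
    have hcut := (hexp (κ := 1 / 32) (by norm_num)).rexp.sub_const 1
    simpa using (hdeg.add (hexp (κ := 1 / 4) (by norm_num))).add hcut
  have hbad : Tendsto (fun k => (S k).graphLaw.real {G | ¬ (S k).IsTypical δ G}) atTop (𝓝 0) := by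
    refine squeeze_zero (fun _ => measureReal_nonneg) (fun k => ?_) hlim
    refine ((S k).measure_not_isTypical_le hδ0.le hδ1).trans ?_
    have hγ : δ ^ 2 / 4 * (S k).crossDegree ≤ (S k).γmin * δ ^ 2 / 4 := by
      nlinarith [(S k).crossDegree_le_γmin, sq_nonneg δ]
    have hdeg : N k * Real.exp (-((S k).γmin * δ ^ 2 / 4)) ≤
        N k * Real.exp (-(δ ^ 2 / 4 * (S k).crossDegree)) := by gcongr
    rw [one_div_mul_eq_div, one_div_mul_eq_div]
    linarith
  rw [← ENNReal.tendsto_toReal_iff (fun _ => measure_ne_top _ _) ENNReal.one_ne_top,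
    ENNReal.toReal_one, ← sub_zero (1 : ℝ)]
  refine (hbad.const_sub 1).congr fun k => ?_
  rw [← probReal_compl_eq_one_sub (Set.toFinite _).measurableSet, Set.compl_ofPred]
  simp only [not_not, Measure.real]

lemma ConnectivityCondition.log_pow_mul_sq_isLittleO (hconn : ConnectivityCondition N M S) :
    (fun k => Real.log (N k) ^ 4 * (S k).γmax ^ 2) =o[atTop] fun k => (S k).γmin ^ 3 := by
  refine (isLittleO_iff_tendsto' ?_).2 (squeeze_zero' ?_ ?_ hconn.2)
  · filter_upwards [hconn.1] with k hγ h0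
    exact absurd h0 (by positivity)
  · filter_upwards [hconn.1] with k hγ
    positivity
  · filter_upwards [hconn.1] with k hγ
    exact (S k).log_pow_mul_sq_div_le_iSup hγ

lemma ConnectivityCondition.log_pow_isLittleO (hconn : ConnectivityCondition N M S) :
    (fun k => Real.log (N k) ^ 4) =o[atTop] fun k => (S k).γmin := by
  refine IsLittleO.of_bound fun c hc => ?_
  filter_upwards [hconn.1, hconn.log_pow_mul_sq_isLittleO.def hc] with k hγ hk
  have hγmax := (S k).γmin_le_γmax
  rw [Real.norm_of_nonneg (by positivity), Real.norm_of_nonneg (by positivity)] at hk ⊢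
  refine le_of_mul_le_mul_right ?_ (pow_pos hγ 2)
  calc Real.log (N k) ^ 4 * (S k).γmin ^ 2 ≤ Real.log (N k) ^ 4 * (S k).γmax ^ 2 := by gcongr
    _ ≤ c * (S k).γmin ^ 3 := hk
    _ = c * (S k).γmin * (S k).γmin ^ 2 := by ring

lemma ConnectivityCondition.tendsto_γmin (hN : Tendsto N atTop atTop)
    (hconn : ConnectivityCondition N M S) : Tendsto (fun k => (S k).γmin) atTop atTop := by
  refine tendsto_atTop_mono' _ ?_
    (Real.tendsto_log_atTop.comp (tendsto_natCast_atTop_atTop.comp hN))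
  filter_upwards [hconn.1, hconn.log_pow_isLittleO.def one_pos, eventually_one_le_log hN]
    with k hγ hk hL
  rw [Real.norm_of_nonneg (by positivity), Real.norm_of_nonneg hγ.le, one_mul] at hk
  exact (le_self_pow₀ hL (by norm_num)).trans hk

lemma CrossBlockCondition.eventually_mul_pmin_le (hN : Tendsto N atTop atTop)
    (hcross : CrossBlockCondition N M S) {c : ℝ} (hc : 0 < c) :
    ∀ᶠ k in atTop, 1 ≤ (N k : ℝ) / M k * (S k).pmin →
      (N k : ℝ) / M k * (S k).pmin ≤ c * (S k).crossDegree ^ 2 := by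
  filter_upwards [hcross.def hc, eventually_one_le_log hN, hN.eventually_gt_atTop 0]
    with k hk hL hNk
  rw [Real.norm_of_nonneg (sq_nonneg _)] at hk
  exact (S k).mul_pmin_le_mul_sq hNk hL ((Real.le_norm_self _).trans hk)

lemma γmin_isLittleO_crossDegree_sq (hN : Tendsto N atTop atTop)
    (hconn : ConnectivityCondition N M S) (hcross : CrossBlockCondition N M S) :
    (fun k => (S k).γmin) =o[atTop] fun k => (S k).crossDegree ^ 2 := by
  refine IsLittleO.of_bound fun c hc => ?_
  have hγmin := hconn.tendsto_γmin hN
  filter_upwards [hconn.1, hγmin.eventually_ge_atTop 2, hγmin.eventually_ge_atTop (4 / c),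
    hcross.eventually_mul_pmin_le hN (half_pos hc)] with k hγ h2 h4 hk
  rw [Real.norm_of_nonneg hγ.le, Real.norm_of_nonneg (sq_nonneg _)]
  rw [(S k).γmin_eq] at h2 h4 ⊢
  exact add_le_mul_sq hc (S k).crossDegree_nonneg h2 h4 hk

lemma log_isLittleO_crossDegree (hN : Tendsto N atTop atTop)
    (hconn : ConnectivityCondition N M S) (hcross : CrossBlockCondition N M S) :
    (fun k => Real.log (N k)) =o[atTop] fun k => (S k).crossDegree := by
  have hlog : (fun k => Real.log (N k) ^ 2) =O[atTop] fun k => Real.log (N k) ^ 4 := by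
    refine .of_bound' ?_
    filter_upwards [eventually_one_le_log hN] with k hL
    rw [Real.norm_of_nonneg (by positivity), Real.norm_of_nonneg (by positivity)]
    exact pow_le_pow_right₀ hL (by norm_num)
  exact .of_pow (hlog.trans_isLittleO (hconn.log_pow_isLittleO.trans
    (γmin_isLittleO_crossDegree_sq hN hconn hcross))) two_ne_zero

lemma γmax_isLittleO_mul_γmin (hN : Tendsto N atTop atTop)
    (hconn : ConnectivityCondition N M S) (hcross : CrossBlockCondition N M S) :
    (fun k => (S k).γmax) =o[atTop] fun k => (S k).crossDegree * (S k).γmin := by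
  have hsq : (fun k => (S k).γmax ^ 2) =O[atTop] fun k => Real.log (N k) ^ 4 * (S k).γmax ^ 2 := by
    refine .of_bound' ?_
    filter_upwards [eventually_one_le_log hN] with k hL
    rw [Real.norm_of_nonneg (by positivity), Real.norm_of_nonneg (by positivity)]
    exact le_mul_of_one_le_left (sq_nonneg _) (one_le_pow₀ hL)
  have hcube : (fun k => (S k).γmin ^ 3) =O[atTop] fun k =>
      ((S k).crossDegree * (S k).γmin) ^ 2 := by
    refine ((γmin_isLittleO_crossDegree_sq hN hconn hcross).isBigO.mul
      (isBigO_refl (fun k => (S k).γmin ^ 2) atTop)).congr (fun k => ?_) fun k => ?_ <;> ring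
  exact .of_pow (hsq.trans_isLittleO (hconn.log_pow_mul_sq_isLittleO.trans_isBigO hcube))
    two_ne_zero

end Asymptotics

end SBM
end

theorem theorem1p2_general (N M : ℕ → ℕ) (hN : Tendsto N atTop atTop)
    (S : ∀ k, SBM.BlockModel (N k) (M k))
    (hlog : (fun k => Real.log (N k)) =o[atTop] fun k => (S k).crossDegree)
    (hγ : (fun k => (S k).γmax) =o[atTop] fun k => (S k).crossDegree * (S k).γmin) :
    ∀ ε : ℝ, 0 < ε →
      Tendsto
        (fun k => (S k).graphLaw {G | ∀ w : Fin (N k),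
          SBM.averageHittingTime G w ≠ ∞ ∧
          |(SBM.averageHittingTime G w).toReal /
              ((N k : ℝ) / (M k : ℝ) * ((∑ m, (S k).γ m) / (S k).γ ((S k).block w))) - 1| ≤ ε})
        atTop (𝓝 1) := by
  intro ε hε
  obtain ⟨δ, hδ0, hδ1, hδε⟩ : ∃ δ : ℝ, 0 < δ ∧ δ ≤ 1 / 2 ∧ 8 * δ ≤ ε :=
    ⟨min (1 / 2) (ε / 8), by positivity, min_le_left _ _, by
      linarith [min_le_right (1 / 2 : ℝ) (ε / 8)]⟩
  refine tendsto_of_tendsto_of_tendsto_of_le_of_le'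
    (SBM.tendsto_measure_isTypical hN hlog hδ0 (by linarith)) tendsto_const_nhds ?_
    (.of_forall fun _ => prob_le_one)
  filter_upwards [SBM.eventually_one_le_log hN, hlog.def one_pos,
    hγ.def (show 0 < δ / 266 by positivity)] with k hL hLy hk
  have hy : 0 < (S k).crossDegree := by
    rw [Real.norm_of_nonneg (S k).crossDegree_nonneg] at hLy
    linarith [Real.le_norm_self (Real.log (N k))]
  have hγmin : 0 < (S k).γmin := hy.trans_le (S k).crossDegree_le_γmin
  have hratio : 266 * ((S k).γmax / ((S k).crossDegree * (S k).γmin)) ≤ δ := by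
    rw [Real.norm_of_nonneg (mul_pos hy hγmin).le] at hk
    rw [← le_div_iff₀' (by norm_num), div_le_iff₀ (mul_pos hy hγmin)]
    exact (Real.le_norm_self _).trans hk
  refine measure_mono fun G hG w => ?_
  exact (hG.abs_averageHittingTime_div_sub_one_le hδ1 hy hratio w).imp_right (·.trans hδε)

theorem theorem1p2 (N M : ℕ → ℕ) (hN : Tendsto N atTop atTop)
    (hM : (fun k => (M k : ℝ)) =o[atTop] fun k => (N k : ℝ))
    (S : ∀ k, SBM.BlockModel (N k) (M k))
    (hconn : SBM.ConnectivityCondition N M S)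
    (hcross : SBM.CrossBlockCondition N M S) :
    ∀ ε : ℝ, 0 < ε →
      Tendsto
        (fun k => (S k).graphLaw {G | ∀ w : Fin (N k),
          SBM.averageHittingTime G w ≠ ∞ ∧
          |(SBM.averageHittingTime G w).toReal /
              ((N k : ℝ) / (M k : ℝ) * ((∑ m, (S k).γ m) / (S k).γ ((S k).block w))) - 1| ≤ ε})
        atTop (𝓝 1) :=
  theorem1p2_general N M hN S (SBM.log_isLittleO_crossDegree hN hconn hcross)
    (SBM.γmax_isLittleO_mul_γmin hN hconn hcross)
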